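/- **Model.** For $p\ge 1$ let $(X,U,Y)\in\mathbb R^p\times[0,1]\times\{0,1\}$, where $\mathbb P(Y=1)=\mathbb P(Y=0)=1/2$, $U$ is independent of $Y$ and has density $h$ on $[0,1]$, and, given $U=u$, $X\sim\mathcal N(\mu_1(u),\Sigma(u))$ if $Y=1$ and $X\sim\mathcal N(\mu_2(u),\Sigma(u))$ if $Y=0$. Put $\mu=(\mu_1+\mu_2)/2$, $Z=Y-\tfrac12$, and let $\theta^*(u)$ be the minimizer over $\theta\in\mathbb R^p$ of $\mathbb E[(Z-\theta^\top(X-\mu(U)))^2\mid U=u]$. **Conditions.** Fix constants $0<\lambda_0\le\lambda_1$, $0<D_1\le D_2$, $D,H,M$, an integer $t\ge 0$ and $r\in(0,1]$ with $d=t+r\ge1$. * (C1) All eigenvalues of $\Sigma(u)$ lie in $[\lambda_0,\lambda_1]$ for every $u\in[0,1]$. * (C2) $D_1\le h(u)\le D_2$ for every $u\in[0,1]$. * (C3) Each entry $f$ of $\mu_1$, $\mu_2$ and $\Sigma^{-1}(\mu_1-\mu_2)$ is $t$ times continuously differentiable on $[0,1]$ with $\sup_x|f^{(\ell)}(x)|\le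 D$ for $0\le\ell\le t$ and $|f^{(t)}(x)-f^{(t)}(x')|\le H|x-x'|^r$. * (C4) $\|\mu_1(u)-\mu_2(u)\|_2\le M$ and $\|\theta^*(u)\|_2\le M$ for every $u\in[0,1]$; and the dimensions $p=p_n\ge1$ satisfy $p_n=o(n^{(2d-1)/(2d+1)})$. **Estimator.** Let $q\ge t$ and $\kappa\geq 1$ be fixed. Let $B_1,\dots,B_{L_n}$ be the B-splines of degree $q$ on $[0,1]$ for a knot sequence with end knots $0$ and $1$ repeated $q+1$ times and simple interior knots, the ratio of the lengths of any two knot intervals being at most $\kappa$, scaled so that $\sum_k B_k=\sqrt{L_n}$; put $B=(B_1,\dots,B_{L_n})^\top$. Assume $L_n\log n/n\to0$. From an i.i.d. sample $(X_i,U_i,Y_i)$, $i=1,\dots,2n$, with $n$ observations in each of the classes $\mathcal I_1=\{i:Y_i=1\}$ and $\mathcal I_2=\{i:Y_i=0\}$, form $$\widehat\mu_{lj}(u)=\widehat\alpha_{lj}^\top B(u),\qquad \widehat\alpha_{lj}=\Big(\sum_{i\in\mathcal I_l}B(U_i)B(U_i)^\top\Big)^{-1}\sum_{i\in\mathcal I_l}B(U_i)X_{ij},\qquad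 j=1,\dots,p,\ l=1,2 .$$ **Proposition.** For every $\vartheta>0$ there is a constant $C>0$, depending only on $\vartheta$, $q$, $\kappa$, $t$, $r$, $\lambda_0,\lambda_1,D_1,D_2,D,H,M$, such that for all sequences $p_n$, $L_n$ as above the following holds for all sufficiently large $n$ (how large may depend on these constants and sequences), for every model and every knot sequence as above. For each $l\in\{1,2\}$, conditionally on the labels $(Y_i)_{i\le 2n}$ being any given configuration with $n$ labels of each kind, with probability at least $1-3p_nL_nn^{-\vartheta}$ the matrix $\sum_{i\in\mathcal I_l}B(U_i)B(U_i)^\top$ is invertible and $$\sup_{u\in[0,1]}\|\widehat\mu_l(u)-\mu_l(u)\|_\infty\le C\Big(\sqrt{\tfrac{L_n\log n}{n}}+L_n^{-d}\Big).$$ -/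

import Mathlib

open MeasureTheory ProbabilityTheory Filter Topology Asymptotics

noncomputable section

namespace VCLDA

/-- Knots `τ 0 ≤ τ 1 ≤ … ≤ τ (L + q)` on `[0,1]` for splines of degree `q` (order `q + 1`) with
`L` basis functions: the two end knots are repeated `q + 1` times, the interior knots are simple,
and the ratio of the lengths of any two knot intervals is at most `κ` (quasi-uniformity).
The values `τ i` with `i > L + q` are never used. -/
structure IsKnotSeq (q L : ℕ) (κ : ℝ) (τ : ℕ → ℝ) : Prop where
  lt_card : q < L
  left : ∀ i, i ≤ q → τ i = 0
  right : ∀ i, L ≤ i → τ i = 1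
  strict : ∀ i, q ≤ i → i < L → τ i < τ (i + 1)
  quasiUniform : ∀ i j, q ≤ i → i < L → q ≤ j → j < L →
    τ (i + 1) - τ i ≤ κ * (τ (j + 1) - τ j)

open Classical in
/-- Standard B-splines on `[0,1]` by the Cox–de Boor recursion (with the usual convention
`x / 0 = 0` at repeated knots); `bspline τ q k` has degree `q` and is supported in
`[τ k, τ (k + q + 1)]`.  The last nonempty knot interval is closed at the right end point `1`. -/
def bspline (τ : ℕ → ℝ) : ℕ → ℕ → ℝ → ℝ
  | 0, k, u =>
      if (τ k ≤ u ∧ u < τ (k + 1)) ∨ (u = 1 ∧ τ k < 1 ∧ τ (k + 1) = 1) then 1 else 0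
  | q + 1, k, u =>
      (u - τ k) / (τ (k + q + 1) - τ k) * bspline τ q k u
        + (τ (k + q + 2) - u) / (τ (k + q + 2) - τ (k + 1)) * bspline τ q (k + 1) u

/-- The scaled B-spline basis vector `B(u)`, normalised so that its entries sum to `√L`. -/
def basis (q L : ℕ) (τ : ℕ → ℝ) (u : ℝ) : Fin L → ℝ :=
  fun k => Real.sqrt L * bspline τ q k u

/-- The space `W^d([0,1])`, `d = t + r`: derivatives up to order `t` bounded by `D` on `[0,1]` and
the `t`-th derivative Hölder continuous with exponent `r` and constant `H`. -/
def holderClass (t : ℕ) (r D H : ℝ) : Set (ℝ → ℝ) :=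
  {f | ContDiffOn ℝ t f (Set.Icc 0 1) ∧
    (∀ ℓ ≤ t, ∀ x ∈ Set.Icc (0 : ℝ) 1, |iteratedDerivWithin ℓ f (Set.Icc 0 1) x| ≤ D) ∧
    ∀ x ∈ Set.Icc (0 : ℝ) 1, ∀ x' ∈ Set.Icc (0 : ℝ) 1,
      |iteratedDerivWithin t f (Set.Icc 0 1) x - iteratedDerivWithin t f (Set.Icc 0 1) x'|
        ≤ H * |x - x'| ^ r}

/-- The parameters of a two-class varying coefficient Gaussian model in dimension `p`.  Labels take
the values `1` and `0`; `mean 1` is the mean function `μ₁` of the class `Y = 1` and `mean 0` the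
mean function `μ₂` of the class `Y = 0`; `cov` is the common covariance function `Σ` and `density`
the density `h` of the exposure variable `U`. Only the values on `[0,1]` matter. -/
structure Model (p : ℕ) where
  mean : Fin 2 → ℝ → EuclideanSpace ℝ (Fin p)
  cov : ℝ → Matrix (Fin p) (Fin p) ℝ
  density : ℝ → ℝ

/-- The pooled mean function `μ = (μ₁ + μ₂) / 2` under equal priors. -/
def Model.pooledMean {p : ℕ} (m : Model p) (u : ℝ) : EuclideanSpace ℝ (Fin p) :=
  (1 / 2 : ℝ) • (m.mean 1 u + m.mean 0 u)

/-- The conditional least squares risk `E[(Z - θᵀ(X - μ(U)))² | U = u]`, where `Z = Y - 1/2`,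
the label is `1` or `0` with probability `1/2` each, and `X ~ N(mean Y u, cov u)`. -/
def Model.condRisk {p : ℕ} (m : Model p) (u : ℝ) (θ : EuclideanSpace ℝ (Fin p)) : ℝ :=
  ∑ y : Fin 2, (1 / 2 : ℝ) *
    ∫ x, (((y : ℕ) : ℝ) - 1 / 2 - inner ℝ θ (x - m.pooledMean u)) ^ 2
      ∂(multivariateGaussian (m.mean y u) (m.cov u))

/-- `θ` is the value at `u` of the population discriminant direction function `θ*`. -/
def Model.IsThetaStar {p : ℕ} (m : Model p) (u : ℝ) (θ : EuclideanSpace ℝ (Fin p)) : Prop :=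
  IsMinOn (m.condRisk u) Set.univ θ

/-- The regularity conditions on one model (those that do not relate the dimension to the sample
size). -/
structure Model.Regular {p : ℕ} (m : Model p) (t : ℕ) (r lam0 lam1 D1 D2 D H M : ℝ) : Prop where
  measurable_cov : ∀ i j, Measurable fun u => m.cov u i j
  measurable_density : Measurable m.density
  eigenvalues_mem : ∀ u ∈ Set.Icc (0 : ℝ) 1, ∃ hS : (m.cov u).IsHermitian,
    ∀ i, lam0 ≤ hS.eigenvalues i ∧ hS.eigenvalues i ≤ lam1
  density_mem : ∀ u ∈ Set.Icc (0 : ℝ) 1, D1 ≤ m.density u ∧ m.density u ≤ D2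
  mean_holder : ∀ y j, (fun u => m.mean y u j) ∈ holderClass t r D H
  direction_holder : ∀ j,
    (fun u => ((m.cov u)⁻¹.mulVec fun i => m.mean 1 u i - m.mean 0 u i) j) ∈ holderClass t r D H
  diff_bound : ∀ u ∈ Set.Icc (0 : ℝ) 1, ‖m.mean 1 u - m.mean 0 u‖ ≤ M
  theta_bound : ∀ u ∈ Set.Icc (0 : ℝ) 1, ∀ θ, m.IsThetaStar u θ → ‖θ‖ ≤ M

/-- `(U i, Y i, X i)`, `i = 0, …, N - 1`, is an i.i.d. sample from the model with equal priors:
`U` has density `h` on `[0,1]`, `Y` is independent of `U` with `P(Y = 1) = P(Y = 0) = 1/2`, and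
given `U = u` and `Y = y` the covariate `X` has the law `N(mean y u, cov u)`. -/
structure IsSample {p N : ℕ} (m : Model p) {Ω : Type*} [MeasurableSpace Ω] (P : Measure Ω)
    (U : Fin N → Ω → ℝ) (Y : Fin N → Ω → Fin 2) (X : Fin N → Ω → EuclideanSpace ℝ (Fin p)) :
    Prop where
  measurable_U : ∀ i, Measurable (U i)
  measurable_Y : ∀ i, Measurable (Y i)
  measurable_X : ∀ i, Measurable (X i)
  indep : iIndepFun (fun i ω => (U i ω, Y i ω, X i ω)) P
  law : ∀ (i : Fin N) (y : Fin 2) (A : Set ℝ) (S : Set (EuclideanSpace ℝ (Fin p))),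
    MeasurableSet A → MeasurableSet S →
      P {ω | U i ω ∈ A ∧ Y i ω = y ∧ X i ω ∈ S} =
        (1 / 2) * ∫⁻ u in A ∩ Set.Icc 0 1,
          ENNReal.ofReal (m.density u) * multivariateGaussian (m.mean y u) (m.cov u) S

/-- The unnormalised Gram matrix `∑ B_i B_iᵀ` over the sample points with label `l`. -/
def gram {N : ℕ} (q L : ℕ) (τ : ℕ → ℝ) (U : Fin N → ℝ) (Y : Fin N → Fin 2) (l : Fin 2) :
    Matrix (Fin L) (Fin L) ℝ :=
  ∑ i with Y i = l, Matrix.vecMulVec (basis q L τ (U i)) (basis q L τ (U i))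

/-- The least squares coefficients `(∑ B_i B_iᵀ)⁻¹ ∑ B_i X_ij` of coordinate `j` in class `l`. -/
def alphaHat {p N : ℕ} (q L : ℕ) (τ : ℕ → ℝ) (U : Fin N → ℝ) (Y : Fin N → Fin 2)
    (X : Fin N → EuclideanSpace ℝ (Fin p)) (l : Fin 2) (j : Fin p) : Fin L → ℝ :=
  (gram q L τ U Y l)⁻¹.mulVec (∑ i with Y i = l, X i j • basis q L τ (U i))

/-- The B-spline estimator of the mean function of class `l`, evaluated at `u`. -/
def muHat {p N : ℕ} (q L : ℕ) (τ : ℕ → ℝ) (U : Fin N → ℝ) (Y : Fin N → Fin 2)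
    (X : Fin N → EuclideanSpace ℝ (Fin p)) (l : Fin 2) (u : ℝ) : Fin p → ℝ :=
  fun j => dotProduct (alphaHat q L τ U Y X l j) (basis q L τ u)

end VCLDA

end

/-! Fix the labels, and suppose that each of `q + 1` separated pieces of every knot interval holds
at least a multiple of `n / L` design points of the class, and every knot interval at most a
multiple. The Gram matrix is then banded, with entries `O(n)` and smallest eigenvalue at least a
multiple of `n`. Such a matrix has an inverse of size `O(1 / n)` in the maximum norm, uniformly in
`L` (`exists_banded_inverse_bound`), so no power of `L` is lost in passing to a uniform bound.

Let `β` be the coefficients of a spline within `O(L ^ (-d))` of a coordinate of the mean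
(`exists_approximation_bound`). By the normal equations the Gram matrix sends the coefficient error
to a noise vector plus a bias vector. The noise entries are `O(√(n log n))`; the bias entries are
`O(n L ^ (-d) / √L)`, because a spline meets only `O(n / L)` points. Division by `n` and
multiplication by `√L = ∑ B_k` give the rate (`exists_estimation_bound`).

Both the eigenvalue bound and the approximation rest on local stability (`exists_stability_bound`):
a B-spline coefficient is controlled by the values of the spline at one point in each piece of a
knot interval in the support. This comes from Marsden's identity and compactness for Vandermonde
systems.

Conditionally on the labels the observations of one class are independent
(`IsSample.lintegral_prod_cond`). Chernoff bounds control the counts and Gaussian tails the noise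
sums. The union bound over `O(L)` counts and `p L` sums yields the factor `3 p L`, and `L log n / n
→ 0` makes the count failures negligible. -/

namespace VCLDA

/-! ### B-splines: local support, Marsden's identity, knot gaps -/

section Splines

variable {q L : ℕ} {κ : ℝ} {τ : ℕ → ℝ}

theorem IsKnotSeq.monotone (hK : IsKnotSeq q L κ τ) : Monotone τ := by
  refine monotone_nat_of_le_succ fun i => ?_
  rcases lt_or_ge i q with h | h
  · rw [hK.left i h.le, hK.left (i + 1) h]
  · rcases lt_or_ge i L with h' | h'
    · exact (hK.strict i h h').le
    · rw [hK.right i h', hK.right (i + 1) (by omega)]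

theorem IsKnotSeq.mem_Icc (hK : IsKnotSeq q L κ τ) (i : ℕ) : τ i ∈ Set.Icc (0 : ℝ) 1 := by
  constructor
  · rw [← hK.left 0 (Nat.zero_le _)]; exact hK.monotone (Nat.zero_le _)
  · rw [← hK.right (max i L) (le_max_right _ _)]; exact hK.monotone (le_max_left _ _)

/-- The point `u` lies in the `m`-th knot interval, in the sense of the convention used by the
splines of degree zero. -/
structure Active (τ : ℕ → ℝ) (m : ℕ) (u : ℝ) : Prop where
  left : τ m ≤ u
  right : u ≤ τ (m + 1)
  indicator : ∀ k, bspline τ 0 k u = if k = m then 1 else 0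

theorem IsKnotSeq.active_of_mem_Ico (hK : IsKnotSeq q L κ τ) {m : ℕ} {u : ℝ}
    (hu : u ∈ Set.Ico (τ m) (τ (m + 1))) : Active τ m u := by
  have hu1 : u < 1 := hu.2.trans_le (hK.mem_Icc _).2
  refine ⟨hu.1, hu.2.le, fun k => ?_⟩
  simp only [bspline]
  by_cases hk : k = m
  · subst hk; rw [if_pos (Or.inl ⟨hu.1, hu.2⟩), if_pos rfl]
  · rw [if_neg hk, if_neg]
    rintro (h | h)
    · rcases lt_or_gt_of_ne hk with h' | h'
      · exact absurd (h.2.trans_le (hK.monotone (show k + 1 ≤ m from h'))) (not_lt.2 hu.1)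
      · exact absurd (hu.2.trans_le (hK.monotone (show m + 1 ≤ k from h'))) (not_lt.2 h.1)
    · exact hu1.ne h.1

/-- At `1` no half-open interval is active. The extra clause in degree zero switches on only the
last nonempty interval, since later knots all equal `1` and earlier intervals end before `1`. -/
theorem IsKnotSeq.active_one (hK : IsKnotSeq q L κ τ) : Active τ (L - 1) 1 := by
  have hL := hK.lt_card
  have e : L - 1 + 1 = L := by omega
  have hlt : τ (L - 1) < 1 := by
    have := hK.strict (L - 1) (by omega) (by omega)
    rwa [e, hK.right L le_rfl] at this
  refine ⟨hlt.le, by rw [e, hK.right L le_rfl], fun k => ?_⟩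
  simp only [bspline]
  by_cases hk : k = L - 1
  · subst hk
    rw [if_pos (Or.inr ⟨trivial, hlt, by rw [e, hK.right L le_rfl]⟩), if_pos rfl]
  · rw [if_neg hk, if_neg]
    rintro (h | h)
    · exact absurd h.2 (not_lt.2 (hK.mem_Icc _).2)
    · rcases lt_or_gt_of_ne hk with h' | h'
      · have := hK.monotone (show k + 1 ≤ L - 1 by omega)
        rw [h.2.2] at this; linarith
      · exact h.2.1.ne (hK.right k (by omega))

theorem IsKnotSeq.exists_mem_Ico (hK : IsKnotSeq q L κ τ) {u : ℝ} (hu : u ∈ Set.Ico (0 : ℝ) 1) :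
    ∃ m, q ≤ m ∧ m < L ∧ u ∈ Set.Ico (τ m) (τ (m + 1)) := by
  classical
  have hex : ∃ k, u < τ k := ⟨L, by rw [hK.right L le_rfl]; exact hu.2⟩
  have h1 := Nat.find_spec hex
  have hq : q < Nat.find hex := by
    by_contra h
    rw [hK.left _ (not_lt.1 h)] at h1
    exact absurd h1 (not_lt.2 hu.1)
  have hL : Nat.find hex ≤ L := Nat.find_min' hex (by rw [hK.right L le_rfl]; exact hu.2)
  refine ⟨Nat.find hex - 1, by omega, by omega, ?_, ?_⟩
  · exact not_lt.1 (Nat.find_min hex (by omega))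
  · rwa [show Nat.find hex - 1 + 1 = Nat.find hex by omega]

theorem IsKnotSeq.exists_active (hK : IsKnotSeq q L κ τ) {u : ℝ} (hu : u ∈ Set.Icc (0 : ℝ) 1) :
    ∃ m, q ≤ m ∧ m < L ∧ Active τ m u := by
  rcases hu.2.lt_or_eq with h | h
  · obtain ⟨m, h1, h2, h3⟩ := hK.exists_mem_Ico ⟨hu.1, h⟩
    exact ⟨m, h1, h2, hK.active_of_mem_Ico h3⟩
  · have := hK.lt_card
    exact ⟨L - 1, by omega, by omega, h ▸ hK.active_one⟩

/-- Expressing the support by the active index rather than by an interval avoids separate cases for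
repeated knots and for the right end point. -/
theorem Active.bspline_eq_zero {m : ℕ} {u : ℝ} (h : Active τ m u) (d k : ℕ)
    (hk : m < k ∨ k + d < m) : bspline τ d k u = 0 := by
  induction d generalizing k with
  | zero => rw [h.indicator, if_neg (by omega)]
  | succ d ih => simp only [bspline]; rw [ih k (by omega), ih (k + 1) (by omega)]; simp

theorem Active.bspline_nonneg (hK : IsKnotSeq q L κ τ) {m : ℕ} {u : ℝ} (h : Active τ m u)
    (d k : ℕ) : 0 ≤ bspline τ d k u := by
  induction d generalizing k with
  | zero => rw [h.indicator]; split_ifs <;> norm_num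
  | succ d ih =>
    by_cases hk : m < k ∨ k + (d + 1) < m
    · rw [h.bspline_eq_zero _ _ hk]
    · have h1 : τ k ≤ τ m := hK.monotone (by omega)
      have h2 : τ (m + 1) ≤ τ (k + d + 2) := hK.monotone (by omega)
      have h3 : τ k ≤ τ (k + d + 1) := hK.monotone (by omega)
      have h4 : τ (k + 1) ≤ τ (k + d + 2) := hK.monotone (by omega)
      have := h.left
      have := h.right
      simp only [bspline]
      exact add_nonneg (mul_nonneg (div_nonneg (by linarith) (by linarith)) (ih k))
        (mul_nonneg (div_nonneg (by linarith) (by linarith)) (ih (k + 1)))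

/-- The exposures lie in `[0,1]` only almost surely. Since the splines vanish elsewhere, the
deterministic bounds need no assumption on the sample points. -/
theorem IsKnotSeq.bspline_eq_zero_of_notMem (hK : IsKnotSeq q L κ τ) {u : ℝ}
    (hu : u ∉ Set.Icc (0 : ℝ) 1) (d k : ℕ) : bspline τ d k u = 0 := by
  induction d generalizing k with
  | zero =>
    simp only [bspline]
    rw [if_neg]
    rintro (h | h)
    · exact hu ⟨(hK.mem_Icc k).1.trans h.1, h.2.le.trans (hK.mem_Icc _).2⟩
    · exact hu ⟨by linarith [h.1], h.1.le⟩
  | succ d ih => simp only [bspline]; rw [ih, ih]; simp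

theorem IsKnotSeq.bspline_nonneg (hK : IsKnotSeq q L κ τ) (d k : ℕ) (u : ℝ) :
    0 ≤ bspline τ d k u := by
  by_cases hu : u ∈ Set.Icc (0 : ℝ) 1
  · obtain ⟨m, -, -, h⟩ := hK.exists_active hu
    exact h.bspline_nonneg hK d k
  · rw [hK.bspline_eq_zero_of_notMem hu]

theorem measurable_bspline (τ : ℕ → ℝ) (d k : ℕ) : Measurable (bspline τ d k) := by
  induction d generalizing k with
  | zero =>
    have : bspline τ 0 k = fun u => if (τ k ≤ u ∧ u < τ (k + 1)) ∨
        (u = 1 ∧ τ k < 1 ∧ τ (k + 1) = 1) then 1 else 0 := by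
      funext u; simp only [bspline]
    rw [this]
    refine Measurable.ite ?_ measurable_const measurable_const
    refine MeasurableSet.union measurableSet_Ico ?_
    exact (measurableSet_singleton (1 : ℝ)).inter (MeasurableSet.const _)
  | succ d ih =>
    have : bspline τ (d + 1) k = fun u => (u - τ k) / (τ (k + d + 1) - τ k) * bspline τ d k u
        + (τ (k + d + 2) - u) / (τ (k + d + 2) - τ (k + 1)) * bspline τ d (k + 1) u := by
      funext u; simp only [bspline]
    rw [this]
    have h1 := ih k
    have h2 := ih (k + 1)
    fun_prop

/-- Marsden's identity. -/
theorem Active.marsden (hK : IsKnotSeq q L κ τ) {m : ℕ} {u : ℝ} (h : Active τ m u) (hm : m < L)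
    (hqm : q ≤ m) (y : ℝ) (d : ℕ) (hd : d ≤ q) :
    ∑ k ∈ Finset.range L, (∏ i ∈ Finset.range d, (τ (k + i + 1) - y)) * bspline τ d k u
      = (u - y) ^ d := by
  induction d with
  | zero => simp [h.indicator, hm]
  | succ d ih =>
    rw [pow_succ', ← ih (by omega)]
    -- Each summand is `u - y` times the summand of degree `d`, plus a telescoping difference. The
    -- reason is that `u - y` is the convex combination of `τ (k + d + 1) - y` and `τ k - y` with
    -- the weights of the recursion.
    have key : ∀ k, (∏ i ∈ Finset.range (d + 1), (τ (k + i + 1) - y)) * bspline τ (d + 1) k u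
        = (u - y) * ((∏ i ∈ Finset.range d, (τ (k + i + 1) - y)) * bspline τ d k u)
          + ((∏ i ∈ Finset.range d, (τ (k + 1 + i + 1) - y)) * (τ (k + 1) - y) *
              ((τ (k + d + 2) - u) / (τ (k + d + 2) - τ (k + 1))) * bspline τ d (k + 1) u
            - (∏ i ∈ Finset.range d, (τ (k + i + 1) - y)) * (τ k - y) *
              ((τ (k + d + 1) - u) / (τ (k + d + 1) - τ k)) * bspline τ d k u) := by
      intro k
      have e1 : ∏ i ∈ Finset.range (d + 1), (τ (k + i + 1) - y)
          = (∏ i ∈ Finset.range d, (τ (k + 1 + i + 1) - y)) * (τ (k + 1) - y) := by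
        rw [Finset.prod_range_succ']
        congr 1
        exact Finset.prod_congr rfl fun i _ => by rw [show k + (i + 1) + 1 = k + 1 + i + 1 by omega]
      have e2 := Finset.prod_range_succ (fun i => τ (k + i + 1) - y) d
      simp only [bspline]
      by_cases hk : m < k ∨ k + d < m
      · rw [h.bspline_eq_zero d k hk, e1]; ring
      · have hne : τ (k + d + 1) - τ k ≠ 0 := by
          have h1 : τ k ≤ τ m := hK.monotone (by omega)
          have h2 : τ (m + 1) ≤ τ (k + d + 1) := hK.monotone (by omega)
          have := hK.strict m hqm hm
          intro h0; linarith
        rw [mul_add]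
        conv_lhs => enter [1, 1]; rw [e2]
        rw [e1]
        generalize (∏ i ∈ Finset.range d, (τ (k + 1 + i + 1) - y)) = A
        generalize (∏ i ∈ Finset.range d, (τ (k + i + 1) - y)) = B
        generalize (τ (k + d + 2) - u) / (τ (k + d + 2) - τ (k + 1)) = ω
        field_simp
        ring
    rw [Finset.sum_congr rfl fun k _ => key k, Finset.sum_add_distrib, ← Finset.mul_sum]
    have tel := Finset.sum_range_sub (fun k => (∏ i ∈ Finset.range d, (τ (k + i + 1) - y)) *
      (τ k - y) * ((τ (k + d + 1) - u) / (τ (k + d + 1) - τ k)) * bspline τ d k u) L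
    have e3 : ∀ k, k + 1 + d + 1 = k + d + 2 := fun k => by omega
    simp only [e3] at tel
    -- The boundary terms vanish: `m < L`, and `d < q ≤ m` keeps `m` out of the support of spline
    -- `0`.
    rw [tel, h.bspline_eq_zero d L (Or.inl hm), h.bspline_eq_zero d 0 (Or.inr (by omega))]
    ring

open Polynomial in
/-- The B-spline coefficient of the `j`-th power of `x - ξ`. -/
noncomputable def marsdenCoeff (τ : ℕ → ℝ) (q : ℕ) (ξ : ℝ) (j k : ℕ) : ℝ :=
  (∏ i ∈ Finset.range q, (X + C (τ (k + i + 1) - ξ))).coeff (q - j) / (q.choose j : ℝ)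

open Polynomial in
-- The coefficient is the `j`-th elementary symmetric function of the `s i`, a sum of `n.choose j`
-- products of `j` factors.
theorem abs_coeff_prod_X_add_C_le (n j : ℕ) (hj : j ≤ n) (s : ℕ → ℝ) (R : ℝ)
    (hs : ∀ i < n, |s i| ≤ R) :
    |(∏ i ∈ Finset.range n, (X + C (s i))).coeff (n - j)| ≤ n.choose j * R ^ j := by
  have h1 := Multiset.prod_X_add_C_coeff' (Finset.range n).val s (k := n - j) (by simp)
  rw [Finset.prod_eq_multiset_prod, h1]
  have h2 : Multiset.card (Finset.range n).val - (n - j) = j := by simp; omega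
  rw [h2, Finset.esymm_map_val]
  refine (Finset.abs_sum_le_sum_abs _ _).trans ?_
  have h3 : ∀ t ∈ (Finset.range n).powersetCard j, |∏ i ∈ t, s i| ≤ R ^ j := by
    intro t ht
    rw [Finset.mem_powersetCard] at ht
    rw [Finset.abs_prod, ← ht.2]
    rw [← Finset.prod_const]
    exact Finset.prod_le_prod (fun i _ => abs_nonneg _) fun i hi =>
      hs i (Finset.mem_range.1 (ht.1 hi))
  refine (Finset.sum_le_card_nsmul _ _ _ h3).trans ?_
  simp

theorem abs_marsdenCoeff_le {ξ R : ℝ} {j k : ℕ} (hj : j ≤ q)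
    (hs : ∀ i < q, |τ (k + i + 1) - ξ| ≤ R) : |marsdenCoeff τ q ξ j k| ≤ R ^ j := by
  have hpos : (0 : ℝ) < q.choose j := by exact_mod_cast Nat.choose_pos hj
  rw [marsdenCoeff, abs_div, abs_of_pos hpos, div_le_iff₀ hpos, mul_comm]
  exact abs_coeff_prod_X_add_C_le q j hj (fun i => τ (k + i + 1) - ξ) R hs

open Polynomial in
-- Marsden's identity at `y = ξ - z` is a polynomial identity in `z`; compare the coefficients of `z
-- ^ (q - j)`.
theorem IsKnotSeq.sum_marsdenCoeff (hK : IsKnotSeq q L κ τ) {u : ℝ} (hu : u ∈ Set.Icc (0 : ℝ) 1)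
    (ξ : ℝ) {j : ℕ} (hj : j ≤ q) :
    ∑ k ∈ Finset.range L, marsdenCoeff τ q ξ j k * bspline τ q k u = (u - ξ) ^ j := by
  obtain ⟨m, h1, h2, h⟩ := hK.exists_active hu
  have hpos : (0 : ℝ) < q.choose j := by exact_mod_cast Nat.choose_pos hj
  have hpoly : ∑ k ∈ Finset.range L, (∏ i ∈ Finset.range q, (X + C (τ (k + i + 1) - ξ))) *
      C (bspline τ q k u) = (X + C (u - ξ)) ^ q := by
    refine Polynomial.funext fun z => ?_
    have := h.marsden hK h2 h1 (ξ - z) q le_rfl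
    simp only [eval_finsetSum, eval_mul, eval_prod, eval_add, eval_X, eval_C, eval_pow]
    rw [show z + (u - ξ) = u - (ξ - z) by ring, ← this]
    exact Finset.sum_congr rfl fun k _ => by
      congr 1; exact Finset.prod_congr rfl fun i _ => by ring
  have hc := congrArg (fun p => p.coeff (q - j)) hpoly
  simp only [finsetSum_coeff, coeff_mul_C, coeff_X_add_C_pow] at hc
  rw [Nat.sub_sub_self hj, Nat.choose_symm hj] at hc
  rw [← mul_left_inj' hpos.ne', ← hc, Finset.sum_mul]
  exact Finset.sum_congr rfl fun k _ => by rw [marsdenCoeff]; field_simp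

theorem IsKnotSeq.sum_bspline (hK : IsKnotSeq q L κ τ) {u : ℝ} (hu : u ∈ Set.Icc (0 : ℝ) 1) :
    ∑ k ∈ Finset.range L, bspline τ q k u = 1 := by
  have h := hK.sum_marsdenCoeff hu 0 (Nat.zero_le q)
  rw [pow_zero] at h
  rw [← h]
  refine Finset.sum_congr rfl fun k _ => ?_
  have hm : (∏ i ∈ Finset.range q, (Polynomial.X + Polynomial.C (τ (k + i + 1) - 0))).Monic :=
    Polynomial.monic_prod_of_monic _ _ fun i _ => Polynomial.monic_X_add_C _
  have hd : (∏ i ∈ Finset.range q,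
      (Polynomial.X + Polynomial.C (τ (k + i + 1) - 0))).natDegree = q := by
    rw [Polynomial.natDegree_prod_of_monic _ _ fun i _ => Polynomial.monic_X_add_C _]; simp
  have : marsdenCoeff τ q 0 0 k = 1 := by
    rw [marsdenCoeff, Nat.sub_zero]
    nth_rewrite 2 [← hd]
    rw [hm.coeff_natDegree]; simp
  rw [this, one_mul]

theorem IsKnotSeq.sum_gaps (hK : IsKnotSeq q L κ τ) :
    ∑ m ∈ Finset.Ico q L, (τ (m + 1) - τ m) = 1 := by
  rw [Finset.sum_Ico_sub τ hK.lt_card.le, hK.right L le_rfl, hK.left q le_rfl, sub_zero]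

theorem IsKnotSeq.one_le_mul_gap (hK : IsKnotSeq q L κ τ) (hκ : 1 ≤ κ) {m : ℕ} (hqm : q ≤ m)
    (hm : m < L) : 1 ≤ κ * L * (τ (m + 1) - τ m) := by
  have hg := sub_pos.2 (hK.strict m hqm hm)
  rw [← hK.sum_gaps]
  calc _ ≤ ∑ _i ∈ Finset.Ico q L, κ * (τ (m + 1) - τ m) := Finset.sum_le_sum fun i hi => by
          rw [Finset.mem_Ico] at hi; exact hK.quasiUniform i m hi.1 hi.2 hqm hm
    _ = (L - q : ℕ) * (κ * (τ (m + 1) - τ m)) := by simp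
    _ ≤ L * (κ * (τ (m + 1) - τ m)) := by
        gcongr; omega
    _ = _ := by ring

theorem IsKnotSeq.mul_gap_le (hK : IsKnotSeq q L κ τ) {m : ℕ} (hqm : q ≤ m)
    (hm : m < L) : L * (τ (m + 1) - τ m) ≤ κ * (q + 1) := by
  have h1 : (L - q : ℕ) * (τ (m + 1) - τ m) ≤ κ := by
    calc _ = ∑ _i ∈ Finset.Ico q L, (τ (m + 1) - τ m) := by
          rw [Finset.sum_const, Nat.card_Ico, nsmul_eq_mul]
      _ ≤ ∑ i ∈ Finset.Ico q L, κ * (τ (i + 1) - τ i) := Finset.sum_le_sum fun i hi => by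
          rw [Finset.mem_Ico] at hi; exact hK.quasiUniform m i hqm hm hi.1 hi.2
      _ = κ := by rw [← Finset.mul_sum, hK.sum_gaps, mul_one]
  have hg := sub_pos.2 (hK.strict m hqm hm)
  -- There are only `L - q` knot intervals; since `L ≥ q + 1`, this is still at least `L / (q + 1)`.
  have h2 : (L : ℝ) ≤ (q + 1) * (L - q : ℕ) := by
    have : L ≤ (q + 1) * (L - q) := by
      obtain ⟨e, he⟩ : ∃ e, L = q + 1 + e := ⟨L - q - 1, by have := hK.lt_card; omega⟩
      subst he
      rw [show q + 1 + e - q = e + 1 by omega]; nlinarith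
    exact_mod_cast this
  calc _ ≤ (q + 1) * (L - q : ℕ) * (τ (m + 1) - τ m) := by gcongr
    _ = (q + 1) * ((L - q : ℕ) * (τ (m + 1) - τ m)) := by ring
    _ ≤ (q + 1) * κ := by gcongr
    _ = _ := by ring

/-- Every knot gap is at most `κ` times the length of the `m`-th knot interval. -/
theorem IsKnotSeq.gap_le (hK : IsKnotSeq q L κ τ) (hκ : 1 ≤ κ) {m : ℕ} (hqm : q ≤ m)
    (hm : m < L) (i : ℕ) : τ (i + 1) - τ i ≤ κ * (τ (m + 1) - τ m) := by
  have hg := sub_pos.2 (hK.strict m hqm hm)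
  rcases lt_or_ge i q with h | h
  · rw [hK.left i h.le, hK.left (i + 1) h]; simp; positivity
  · rcases lt_or_ge i L with h' | h'
    · exact hK.quasiUniform i m h h' hqm hm
    · rw [hK.right i h', hK.right (i + 1) (by omega)]; simp; positivity

theorem IsKnotSeq.sub_le (hK : IsKnotSeq q L κ τ) (hκ : 1 ≤ κ) {m : ℕ} (hqm : q ≤ m)
    (hm : m < L) (i e : ℕ) : τ (i + e) - τ i ≤ e * (κ * (τ (m + 1) - τ m)) := by
  induction e with
  | zero => simp
  | succ e ih =>
    have := hK.gap_le hκ hqm hm (i + e)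
    push_cast
    rw [← add_assoc]
    linarith

theorem IsKnotSeq.abs_sub_le (hK : IsKnotSeq q L κ τ) (hκ : 1 ≤ κ) {m : ℕ} (hqm : q ≤ m)
    (hm : m < L) {i j N : ℕ} (hij : i ≤ j + N) (hji : j ≤ i + N) :
    |τ i - τ j| ≤ N * (κ * (τ (m + 1) - τ m)) := by
  have hg := sub_pos.2 (hK.strict m hqm hm)
  have h0 : 0 ≤ κ * (τ (m + 1) - τ m) := by positivity
  rw [abs_sub_le_iff]
  constructor
  · have h1 := hK.monotone hij
    have := hK.sub_le hκ hqm hm j N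
    linarith
  · have h1 := hK.monotone hji
    have := hK.sub_le hκ hqm hm i N
    linarith

end Splines

/-! ### Inverses of banded positive definite matrices in the maximum norm -/

section BandedInverse

/-- As `θ → 1` the left side tends to `0` and the right side to `η`. The weights `θ ^ |i - k|` then
vary so little across a band of width `q` that conjugating by them is a small perturbation. -/
theorem exists_weight_near_one (q : ℕ) {η : ℝ} (hη : 0 < η) :
    ∃ θ : ℝ, 0 < θ ∧ θ < 1 ∧ (1 - θ ^ q) ^ 2 ≤ η * θ ^ q := by
  have h : Tendsto (fun θ : ℝ => η * θ ^ q - (1 - θ ^ q) ^ 2) (𝓝[<] 1) (𝓝 η) := by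
    have : ContinuousAt (fun θ : ℝ => η * θ ^ q - (1 - θ ^ q) ^ 2) 1 := by fun_prop
    have h2 := this.tendsto
    simp only [one_pow, mul_one, sub_self, ne_eq, OfNat.ofNat_ne_zero, not_false_eq_true,
      zero_pow, sub_zero] at h2
    exact h2.mono_left nhdsWithin_le_nhds
  have h1 := h.eventually (lt_mem_nhds hη)
  have h2 : ∀ᶠ θ : ℝ in 𝓝[<] 1, θ ∈ Set.Ioo (0 : ℝ) 1 := Ioo_mem_nhdsLT zero_lt_one
  obtain ⟨θ, h3, h4⟩ := (h1.and h2).exists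
  exact ⟨θ, h4.1, h4.2, by linarith⟩

/-- With truncated subtraction the exponent is `|j - k|`, so two geometric series bound the sum. -/
theorem sum_pow_dist_le (L k : ℕ) {θ : ℝ} (h0 : 0 < θ) (h1 : θ < 1) :
    ∑ j : Fin L, θ ^ (((j : ℕ) - k) + (k - (j : ℕ))) ≤ 2 / (1 - θ) := by
  rw [Fin.sum_univ_eq_sum_range (fun j => θ ^ ((j - k) + (k - j))) L]
  have hg : ∀ N : ℕ, ∑ i ∈ Finset.range N, θ ^ i ≤ 1 / (1 - θ) := fun N => by
    have hp : 0 < 1 - θ := by linarith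
    rw [le_div_iff₀ hp, geom_sum_mul_neg]
    have := pow_pos h0 N
    linarith
  calc _ ≤ ∑ j ∈ Finset.range (k + L), θ ^ ((j - k) + (k - j)) :=
        Finset.sum_le_sum_of_subset_of_nonneg (Finset.range_mono (by omega))
          fun _ _ _ => by positivity
    _ = ∑ j ∈ Finset.range k, θ ^ ((j - k) + (k - j)) + ∑ i ∈ Finset.range L, θ ^ i := by
        rw [Finset.sum_range_add]
        congr 1
        exact Finset.sum_congr rfl fun i _ => by congr 1; omega
    _ ≤ ∑ j ∈ Finset.range k, θ ^ j + ∑ i ∈ Finset.range L, θ ^ i := by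
        gcongr ?_ + _
        rw [← Finset.sum_range_reflect (fun j => θ ^ j)]
        refine Finset.sum_le_sum fun j hj => ?_
        exact pow_le_pow_of_le_one h0.le h1.le (by omega)
    _ ≤ 1 / (1 - θ) + 1 / (1 - θ) := add_le_add (hg k) (hg L)
    _ = _ := by ring

theorem sq_sub_pow_le {θ η : ℝ} {q : ℕ} (h0 : 0 < θ) (h1 : θ < 1)
    (hη : (1 - θ ^ q) ^ 2 ≤ η * θ ^ q) {m n : ℕ} (hmn : m ≤ n + q) (hnm : n ≤ m + q) :
    (θ ^ m - θ ^ n) ^ 2 ≤ η * (θ ^ m * θ ^ n) := by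
  have hη0 : 0 ≤ η := by
    by_contra h
    nlinarith [pow_pos h0 q, sq_nonneg (1 - θ ^ q)]
  wlog h : m ≤ n generalizing m n
  · have := this hnm hmn (by omega)
    nlinarith
  obtain ⟨e, rfl⟩ := Nat.exists_eq_add_of_le h
  have he : θ ^ q ≤ θ ^ e := pow_le_pow_of_le_one h0.le h1.le (by omega)
  have he1 : θ ^ e ≤ 1 := pow_le_one₀ h0.le h1.le
  have h2 : (1 - θ ^ e) ^ 2 ≤ η * θ ^ e := by
    calc (1 - θ ^ e) ^ 2 ≤ (1 - θ ^ q) ^ 2 := by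
          apply pow_le_pow_left₀ <;> linarith
      _ ≤ η * θ ^ q := hη
      _ ≤ _ := by gcongr
  rw [pow_add]
  calc (θ ^ m - θ ^ m * θ ^ e) ^ 2 = (θ ^ m) ^ 2 * (1 - θ ^ e) ^ 2 := by ring
    _ ≤ (θ ^ m) ^ 2 * (η * θ ^ e) := by gcongr
    _ = _ := by ring

theorem card_band_le (L q : ℕ) (i : Fin L) :
    (Finset.univ.filter fun j : Fin L => (i : ℕ) ≤ j + q ∧ (j : ℕ) ≤ i + q).card ≤ 2 * q + 1 := by
  have : ((Finset.univ.filter fun j : Fin L => (i : ℕ) ≤ j + q ∧ (j : ℕ) ≤ i + q).map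
      Fin.valEmbedding) ⊆ Finset.Ico ((i : ℕ) - q) (i + q + 1) := by
    intro x hx
    simp only [Finset.mem_map, Finset.mem_filter, Finset.mem_univ, true_and,
      Fin.valEmbedding_apply] at hx
    obtain ⟨j, hj, rfl⟩ := hx
    rw [Finset.mem_Ico]; omega
  have h := Finset.card_le_card this
  rw [Finset.card_map, Nat.card_Ico] at h
  omega

/-- A banded symmetric positive definite matrix with bounded condition number is boundedly
invertible for the maximum norm. -/
theorem exists_banded_inverse_bound (q : ℕ) {ρ : ℝ} (hρ : 0 < ρ) :
    ∃ C : ℝ, 0 < C ∧ ∀ (L : ℕ) (A : Matrix (Fin L) (Fin L) ℝ) (s : ℝ), 0 < s →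
      (∀ i j, A i j = A j i) → (∀ i j, |A i j| ≤ ρ * s) →
      (∀ i j : Fin L, ¬ ((i : ℕ) ≤ j + q ∧ (j : ℕ) ≤ i + q) → A i j = 0) →
      (∀ x : Fin L → ℝ, s * ∑ i, x i ^ 2 ≤ ∑ i, ∑ j, x i * A i j * x j) →
      ∀ (w : Fin L → ℝ) (V : ℝ), (∀ i, |A.mulVec w i| ≤ V) → ∀ k, |w k| ≤ C * V / s := by
  -- A row has at most `2 * q + 1` entries in the band, each at most `ρ * s`, so this `η` makes the
  -- commutator term at most `s * S`.
  obtain ⟨θ, h0, h1, hθ⟩ := exists_weight_near_one q (η := 1 / (ρ * (2 * q + 1))) (by positivity)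
  set η := 1 / (ρ * (2 * q + 1)) with hη
  have hη0 : 0 < η := by positivity
  have h1' : 0 < 1 - θ := by linarith
  refine ⟨Real.sqrt (8 / (1 - θ)), by positivity, ?_⟩
  intro L A s hs hsymm hbd hband hpos w V hV k
  -- The weights are centred at the coordinate `k` to be bounded: there `y k = w k`, while the
  -- squares of the weights have a sum independent of `L`.
  set e : Fin L → ℕ := fun j => ((j : ℕ) - k) + (k - (j : ℕ)) with he
  set y : Fin L → ℝ := fun j => θ ^ e j * w j with hy
  set S := ∑ j, y j ^ 2 with hS
  have hV0 : 0 ≤ V := (abs_nonneg _).trans (hV k)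
  have hS0 : 0 ≤ S := Finset.sum_nonneg fun _ _ => sq_nonneg _
  -- the weighted energy identity
  have hid : ∑ i, ∑ j, y i * A i j * y j = ∑ i, θ ^ e i * y i * A.mulVec w i
      - 1 / 2 * ∑ i, ∑ j, (θ ^ e i - θ ^ e j) ^ 2 * (w i * A i j * w j) := by
    have h2 : ∑ i, θ ^ e i * y i * A.mulVec w i
        = ∑ i, ∑ j, (θ ^ e i) ^ 2 * (w i * A i j * w j) := by
      refine Finset.sum_congr rfl fun i _ => ?_
      rw [Matrix.mulVec, dotProduct, Finset.mul_sum]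
      exact Finset.sum_congr rfl fun j _ => by simp only [hy]; ring
    have h3 : ∑ i, θ ^ e i * y i * A.mulVec w i
        = ∑ i, ∑ j, (θ ^ e j) ^ 2 * (w i * A i j * w j) := by
      rw [h2, Finset.sum_comm]
      exact Finset.sum_congr rfl fun i _ => Finset.sum_congr rfl fun j _ => by
        rw [hsymm j i]; ring
    have h4 : ∑ i, ∑ j, (θ ^ e i - θ ^ e j) ^ 2 * (w i * A i j * w j)
        = ∑ i, ∑ j, (θ ^ e i) ^ 2 * (w i * A i j * w j)
          + ∑ i, ∑ j, (θ ^ e j) ^ 2 * (w i * A i j * w j)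
          - 2 * ∑ i, ∑ j, y i * A i j * y j := by
      simp only [Finset.mul_sum, ← Finset.sum_add_distrib, ← Finset.sum_sub_distrib]
      exact Finset.sum_congr rfl fun i _ => Finset.sum_congr rfl fun j _ => by
        simp only [hy]; ring
    rw [h4, ← h2, ← h3]; ring
  have hrem : |∑ i, ∑ j, (θ ^ e i - θ ^ e j) ^ 2 * (w i * A i j * w j)| ≤ s * S := by
    set band : Fin L → Fin L → Prop := fun i j => (i : ℕ) ≤ j + q ∧ (j : ℕ) ≤ i + q with hb
    have hterm : ∀ i j, |(θ ^ e i - θ ^ e j) ^ 2 * (w i * A i j * w j)|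
        ≤ if band i j then η * (ρ * s) * ((y i ^ 2 + y j ^ 2) / 2) else 0 := by
      intro i j
      split_ifs with hij
      · rw [abs_mul, abs_mul, abs_mul, abs_of_nonneg (sq_nonneg (θ ^ e i - θ ^ e j))]
        have hw := sq_sub_pow_le h0 h1 hθ (m := e i) (n := e j)
          (by simp only [hb, he] at hij ⊢; omega) (by simp only [hb, he] at hij ⊢; omega)
        calc _ ≤ η * (θ ^ e i * θ ^ e j) * (|w i| * (ρ * s) * |w j|) := by
              gcongr; exact hbd i j
          _ = η * (ρ * s) * (|y i| * |y j|) := by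
              simp only [hy, abs_mul, abs_of_pos (pow_pos h0 _)]; ring
          _ ≤ _ := by
              gcongr
              nlinarith [sq_nonneg (|y i| - |y j|), sq_abs (y i), sq_abs (y j)]
      · rw [hband i j hij]; simp
    have hcard : ∀ i, ∑ j, (if band i j then y i ^ 2 else 0) ≤ (2 * q + 1) * y i ^ 2 := by
      intro i
      rw [← Finset.sum_filter, Finset.sum_const, nsmul_eq_mul]
      gcongr
      exact_mod_cast card_band_le L q i
    have hsum1 : ∑ i, ∑ j, (if band i j then y i ^ 2 else 0) ≤ (2 * q + 1) * S := by
      rw [hS, Finset.mul_sum]; exact Finset.sum_le_sum fun i _ => hcard i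
    have hsum2 : ∑ i, ∑ j, (if band i j then y j ^ 2 else 0) ≤ (2 * q + 1) * S := by
      rw [Finset.sum_comm, hS, Finset.mul_sum]
      refine Finset.sum_le_sum fun i _ => le_trans (le_of_eq ?_) (hcard i)
      refine Finset.sum_congr rfl fun j _ => ?_
      have : band j i ↔ band i j := by simp only [hb]; tauto
      simp only [this]
    calc _ ≤ ∑ i, ∑ j, |(θ ^ e i - θ ^ e j) ^ 2 * (w i * A i j * w j)| :=
          (Finset.abs_sum_le_sum_abs _ _).trans
            (Finset.sum_le_sum fun i _ => Finset.abs_sum_le_sum_abs _ _)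
      _ ≤ ∑ i, ∑ j, (if band i j then η * (ρ * s) * ((y i ^ 2 + y j ^ 2) / 2) else 0) :=
          Finset.sum_le_sum fun i _ => Finset.sum_le_sum fun j _ => hterm i j
      _ = η * (ρ * s) / 2 * (∑ i, ∑ j, (if band i j then y i ^ 2 else 0)
            + ∑ i, ∑ j, (if band i j then y j ^ 2 else 0)) := by
          simp only [Finset.mul_sum, ← Finset.sum_add_distrib]
          refine Finset.sum_congr rfl fun i _ => Finset.sum_congr rfl fun j _ => ?_
          split_ifs <;> ring
      _ ≤ η * (ρ * s) / 2 * ((2 * q + 1) * S + (2 * q + 1) * S) := by gcongr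
      _ = s * S := by rw [hη]; field_simp; ring
  -- Coercivity gives `s * S` on the left, and the commutator, taken with factor `1 / 2`, absorbs
  -- half of it.
  have hmain : s / 2 * S ≤ V * ∑ i, θ ^ e i * |y i| := by
    have h2 := hpos y
    have h3 : ∑ i, θ ^ e i * y i * A.mulVec w i ≤ V * ∑ i, θ ^ e i * |y i| := by
      rw [Finset.mul_sum]
      refine Finset.sum_le_sum fun i _ => (le_abs_self _).trans ?_
      rw [abs_mul, abs_mul, abs_of_pos (pow_pos h0 _), mul_comm]
      gcongr
      exact hV i
    have h4 := (abs_le.1 hrem).1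
    rw [hid] at h2
    linarith
  have hW : ∑ i, (θ ^ e i) ^ 2 ≤ 2 / (1 - θ) := by
    refine le_trans (Finset.sum_le_sum fun i _ => ?_) (sum_pow_dist_le L k h0 h1)
    have h2 : θ ^ e i ≤ 1 := pow_le_one₀ h0.le h1.le
    have h3 := pow_pos h0 (e i)
    nlinarith
  have hcs : (∑ i, θ ^ e i * |y i|) ^ 2 ≤ 2 / (1 - θ) * S := by
    refine (Finset.sum_mul_sq_le_sq_mul_sq _ _ _).trans ?_
    simp only [sq_abs]
    gcongr
  have hSle : S ≤ 8 / (1 - θ) * (V / s) ^ 2 := by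
    rcases hS0.eq_or_lt with h | h
    · rw [← h]; positivity
    · have h2 : (s / 2 * S) ^ 2 ≤ V ^ 2 * (2 / (1 - θ) * S) := by
        calc _ ≤ (V * ∑ i, θ ^ e i * |y i|) ^ 2 := by gcongr
          _ = V ^ 2 * (∑ i, θ ^ e i * |y i|) ^ 2 := by ring
          _ ≤ _ := by gcongr
      have h3 : (s ^ 2 / 4 * S) * S ≤ (2 * V ^ 2 / (1 - θ)) * S := by
        calc _ = (s / 2 * S) ^ 2 := by ring
          _ ≤ _ := h2
          _ = _ := by ring
      have h4 := le_of_mul_le_mul_right h3 h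
      calc S = (s ^ 2 / 4 * S) * (4 / s ^ 2) := by field_simp
        _ ≤ (2 * V ^ 2 / (1 - θ)) * (4 / s ^ 2) := by gcongr
        _ = _ := by ring
  have hk : w k ^ 2 ≤ S := by
    have h2 : y k = w k := by simp [hy, he]
    rw [← h2]
    exact Finset.single_le_sum (f := fun j => y j ^ 2) (fun _ _ => sq_nonneg _)
      (Finset.mem_univ k)
  rw [← Real.sqrt_sq_eq_abs, mul_div_assoc, ← Real.sqrt_sq (show 0 ≤ V / s by positivity),
    ← Real.sqrt_mul (by positivity)]
  exact Real.sqrt_le_sqrt (hk.trans hSle)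

end BandedInverse

/-! ### Taylor expansion with Hölder remainder -/

section Taylor

/-- Induction on `t`: the derivative of the remainder of `f` is the remainder of `f'` of one order
less, and the mean value inequality supplies one more factor `|y - x|`. -/
theorem abs_sub_taylor_le {r H : ℝ} (hr : 0 < r) (t : ℕ) (f : ℝ → ℝ)
    (hf : ContDiffOn ℝ t f (Set.Icc 0 1))
    (hH : ∀ x ∈ Set.Icc (0 : ℝ) 1, ∀ x' ∈ Set.Icc (0 : ℝ) 1,
      |iteratedDerivWithin t f (Set.Icc 0 1) x - iteratedDerivWithin t f (Set.Icc 0 1) x'|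
        ≤ H * |x - x'| ^ r)
    {x y : ℝ} (hx : x ∈ Set.Icc (0 : ℝ) 1) (hy : y ∈ Set.Icc (0 : ℝ) 1) :
    |f y - ∑ j ∈ Finset.range (t + 1),
      iteratedDerivWithin j f (Set.Icc 0 1) x / j.factorial * (y - x) ^ j|
        ≤ H * |y - x| ^ (t + r) := by
  have hH0 : 0 ≤ H := by
    have := (abs_nonneg _).trans (hH 0 (by simp) 1 (by simp))
    simpa using this
  induction t generalizing f y with
  | zero => simpa using hH y hy x hx
  | succ t ih =>
    set I := Set.Icc (0 : ℝ) 1 with hI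
    have hu : UniqueDiffOn ℝ I := uniqueDiffOn_Icc_zero_one
    have hf' : ContDiffOn ℝ t (derivWithin f I) I := by
      have h2 : ContDiffOn ℝ ((t : ℕ∞) + 1 : WithTop ℕ∞) f I := by exact_mod_cast hf
      exact ((contDiffOn_succ_iff_derivWithin hu).1 h2).2.2
    have hd : DifferentiableOn ℝ f I := hf.differentiableOn (by simp)
    have hit : ∀ j, iteratedDerivWithin j (derivWithin f I) I
        = iteratedDerivWithin (j + 1) f I := fun j => by
      rw [iteratedDerivWithin_succ']
    have hbound : ∀ z ∈ I, |derivWithin f I z - ∑ j ∈ Finset.range (t + 1),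
        iteratedDerivWithin (j + 1) f I x / j.factorial * (z - x) ^ j| ≤ H * |z - x| ^ (t + r) := by
      intro z hz
      have h2 := ih (derivWithin f I) hf' (fun a ha b hb => by rw [hit]; exact hH a ha b hb) hz
      simpa only [hit] using h2
    set R : ℝ → ℝ := fun z => f z - ∑ j ∈ Finset.range (t + 1 + 1),
      iteratedDerivWithin j f I x / j.factorial * (z - x) ^ j with hR
    have hsub : Set.uIcc x y ⊆ I := Set.uIcc_subset_Icc hx hy
    have hder : ∀ z ∈ Set.uIcc x y, HasDerivWithinAt R (derivWithin f I z -
        ∑ j ∈ Finset.range (t + 1), iteratedDerivWithin (j + 1) f I x / j.factorial * (z - x) ^ j)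
        (Set.uIcc x y) z := by
      intro z hz
      refine ((hd z (hsub hz)).hasDerivWithinAt.mono hsub).sub ?_
      simp only [Finset.sum_range_succ' _ (t + 1), pow_zero]
      suffices hs : HasDerivWithinAt (fun z => ∑ j ∈ Finset.range (t + 1),
          iteratedDerivWithin (j + 1) f I x / (j + 1).factorial * (z - x) ^ (j + 1))
          (∑ j ∈ Finset.range (t + 1),
            iteratedDerivWithin (j + 1) f I x / j.factorial * (z - x) ^ j) (Set.uIcc x y) z from
        hs.add_const _
      refine HasDerivWithinAt.fun_sum fun j _ => ?_
      have h2 : HasDerivAt (fun z : ℝ => (z - x) ^ (j + 1)) ((j + 1 : ℕ) * (z - x) ^ j * 1) z := by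
        simpa using ((hasDerivAt_id z).sub_const x).fun_pow (j + 1)
      have h3 := (h2.const_mul (iteratedDerivWithin (j + 1) f I x / (j + 1).factorial))
      convert h3.hasDerivWithinAt using 1
      rw [Nat.factorial_succ]
      push_cast
      have : (j : ℝ) + 1 ≠ 0 := by positivity
      field_simp
    have hb2 : ∀ z ∈ Set.uIcc x y, ‖derivWithin f I z - ∑ j ∈ Finset.range (t + 1),
        iteratedDerivWithin (j + 1) f I x / j.factorial * (z - x) ^ j‖ ≤ H * |y - x| ^ (t + r) := by
      intro z hz
      refine (hbound z (hsub hz)).trans ?_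
      gcongr H * ?_
      refine Real.rpow_le_rpow (abs_nonneg _) ?_ (by positivity)
      exact Set.abs_sub_left_of_mem_uIcc hz
    have hmv := Convex.norm_image_sub_le_of_norm_hasDerivWithin_le hder hb2
      (convex_uIcc x y) Set.left_mem_uIcc Set.right_mem_uIcc
    have hRx : R x = 0 := by
      simp only [hR, Finset.sum_range_succ' _ (t + 1)]
      simp
    rw [hRx, sub_zero, Real.norm_eq_abs, Real.norm_eq_abs] at hmv
    refine hmv.trans (le_of_eq ?_)
    rcases eq_or_ne (|y - x|) 0 with h | h
    · rw [h, mul_zero, Real.zero_rpow (by positivity), mul_zero]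
    · push_cast
      rw [show (t : ℝ) + 1 + r = (t + r) + 1 by ring, Real.rpow_add_one h]; ring

end Taylor

/-! ### Local stability of B-splines and spline approximation -/

/-- The `a`-th of `q + 1` separated closed pieces of `[0,1)`. -/
def piece (q a : ℕ) : Set ℝ := Set.Icc ((2 * a) / (2 * q + 2)) ((2 * a + 1) / (2 * q + 2))

/-- The `a`-th of `q + 1` separated closed pieces of the `m`-th knot interval. -/
def knotPiece (τ : ℕ → ℝ) (q m a : ℕ) : Set ℝ :=
  Set.Icc (τ m + (2 * a) / (2 * q + 2) * (τ (m + 1) - τ m))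
    (τ m + (2 * a + 1) / (2 * q + 2) * (τ (m + 1) - τ m))

/-- Points from different pieces are distinct, so the Vandermonde matrix is nonsingular and the sum
of squares is positive for `b ≠ 0`. The pieces are closed, so by compactness it has a positive
minimum over unit vectors `b`; homogeneity does the rest. -/
theorem exists_vandermonde_bound (q : ℕ) :
    ∃ C : ℝ, 0 < C ∧ ∀ b z : Fin (q + 1) → ℝ, (∀ a : Fin (q + 1), z a ∈ piece q a) →
      ∀ j, b j ^ 2 ≤ C * ∑ a, (∑ j, b j * z a ^ (j : ℕ)) ^ 2 := by
  set F : (Fin (q + 1) → ℝ) × (Fin (q + 1) → ℝ) → ℝ :=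
    fun bz => ∑ a, (∑ j, bz.1 j * bz.2 a ^ (j : ℕ)) ^ 2 with hF
  have hFc : Continuous F := by fun_prop
  set K : Set ((Fin (q + 1) → ℝ) × (Fin (q + 1) → ℝ)) :=
    Metric.sphere 0 1 ×ˢ Set.pi Set.univ fun a : Fin (q + 1) => piece q a with hK
  have hKc : IsCompact K :=
    (isCompact_sphere _ _).prod (isCompact_univ_pi fun a => isCompact_Icc)
  have hpos : ∀ bz ∈ K, 0 < F bz := by
    rintro ⟨b, z⟩ ⟨hb, hz⟩
    simp only [Set.mem_pi, Set.mem_univ, true_implies] at hz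
    refine lt_of_le_of_ne (Finset.sum_nonneg fun _ _ => sq_nonneg _) fun h0 => ?_
    have h1 : ∀ a, ∑ j, b j * z a ^ (j : ℕ) = 0 := by
      have := (Finset.sum_eq_zero_iff_of_nonneg fun a _ => sq_nonneg
        (∑ j, b j * z a ^ (j : ℕ))).1 h0.symm
      intro a
      exact pow_eq_zero_iff two_ne_zero |>.1 (this a (Finset.mem_univ _))
    have hinj : Function.Injective z := by
      have hlt : ∀ a a' : Fin (q + 1), a < a' → z a < z a' := by
        intro a a' h
        have h2 : ((a : ℕ) : ℝ) + 1 ≤ (a' : ℕ) := by exact_mod_cast h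
        refine (hz a).2.trans_lt (lt_of_lt_of_le ?_ (hz a').1)
        have : (0 : ℝ) < 2 * q + 2 := by positivity
        rw [div_lt_div_iff_of_pos_right this]; linarith
      intro a a' h
      rcases lt_trichotomy a a' with h' | h' | h'
      · exact absurd h (hlt _ _ h').ne
      · exact h'
      · exact absurd h (hlt _ _ h').ne'
    have hdet : (Matrix.vandermonde z).det ≠ 0 := Matrix.det_vandermonde_ne_zero_iff.2 hinj
    have hb0 : b = 0 := by
      refine Matrix.eq_zero_of_mulVec_eq_zero hdet ?_
      funext a
      simp only [Matrix.mulVec, dotProduct, Matrix.vandermonde_apply, Pi.zero_apply]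
      rw [← h1 a]
      exact Finset.sum_congr rfl fun j _ => mul_comm _ _
    simp [hb0] at hb
  have hδ : ∃ δ > 0, ∀ bz ∈ K, δ ≤ F bz := by
    rcases K.eq_empty_or_nonempty with h | h
    · exact ⟨1, one_pos, by simp [h]⟩
    · obtain ⟨x, hx, hmin⟩ := hKc.exists_isMinOn h hFc.continuousOn
      exact ⟨F x, hpos x hx, fun y hy => hmin hy⟩
  obtain ⟨δ, hδ, hmin⟩ := hδ
  refine ⟨1 / δ, by positivity, fun b z hz j => ?_⟩
  rcases eq_or_ne b 0 with rfl | hb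
  · simp
  have hn : 0 < ‖b‖ := norm_pos_iff.2 hb
  have h1 := hmin (‖b‖⁻¹ • b, z) ⟨by simp [norm_smul, hn.ne'], by simpa using hz⟩
  have h2 : F (‖b‖⁻¹ • b, z) = (‖b‖⁻¹) ^ 2 * F (b, z) := by
    simp only [hF, Finset.mul_sum, Pi.smul_apply, smul_eq_mul, ← mul_pow]
    refine Finset.sum_congr rfl fun a _ => ?_
    congr 1
    exact Finset.sum_congr rfl fun j _ => by ring
  have h3 : ‖b‖ ^ 2 ≤ 1 / δ * F (b, z) := by
    rw [h2, inv_pow, inv_mul_eq_div, le_div_iff₀ (by positivity)] at h1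
    rw [div_mul_eq_mul_div, one_mul, le_div_iff₀ hδ]; linarith
  refine le_trans ?_ h3
  rw [← sq_abs, ← Real.norm_eq_abs]
  gcongr
  exact norm_le_pi_norm b j

variable {q L : ℕ} {κ : ℝ} {τ : ℕ → ℝ}

theorem knotPiece_subset_Ico {m a : ℕ} (ha : a ≤ q) (hm : τ m < τ (m + 1)) :
    knotPiece τ q m a ⊆ Set.Ico (τ m) (τ (m + 1)) := by
  intro x hx
  have hg := sub_pos.2 hm
  have ha' : (a : ℝ) ≤ q := by exact_mod_cast ha
  have h1 : (0 : ℝ) ≤ (2 * a) / (2 * q + 2) * (τ (m + 1) - τ m) := by positivity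
  have h2 : (2 * a + 1 : ℝ) / (2 * q + 2) < 1 := by
    rw [div_lt_one (by positivity)]; linarith
  have h3 : (2 * a + 1 : ℝ) / (2 * q + 2) * (τ (m + 1) - τ m) < 1 * (τ (m + 1) - τ m) := by
    gcongr
  exact ⟨by linarith [hx.1], by linarith [hx.2]⟩

theorem scaled_mem_piece {m a : ℕ} (hm : τ m < τ (m + 1)) {x : ℝ}
    (hx : x ∈ knotPiece τ q m a) : (x - τ m) / (τ (m + 1) - τ m) ∈ piece q a := by
  have hg := sub_pos.2 hm
  constructor
  · rw [le_div_iff₀ hg]; linarith [hx.1]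
  · rw [div_le_iff₀ hg]; linarith [hx.2]

theorem Active.sum_eq_window {m : ℕ} {u : ℝ} (h : Active τ m u) (hqm : q ≤ m) (hm : m < L)
    (f : ℕ → ℝ) : ∑ k ∈ Finset.range L, f k * bspline τ q k u
      = ∑ i : Fin (q + 1), f (m - q + i) * bspline τ q (m - q + i) u := by
  rw [Fin.sum_univ_eq_sum_range (fun i => f (m - q + i) * bspline τ q (m - q + i) u) (q + 1)]
  have := Finset.sum_Ico_eq_sum_range (fun k => f k * bspline τ q k u) (m - q) (m + 1)
  rw [show m + 1 - (m - q) = q + 1 by omega] at this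
  rw [← this]
  symm
  refine Finset.sum_subset (fun k hk => ?_) fun k _ hk => ?_
  · rw [Finset.mem_Ico] at hk; rw [Finset.mem_range]; omega
  · rw [Finset.mem_Ico] at hk
    rw [h.bspline_eq_zero q k (by omega), mul_zero]

/-- The coefficients of a polynomial, in powers of the scaled variable on the `m`-th interval. -/
noncomputable def localCoeff (τ : ℕ → ℝ) (q m : ℕ) (b : Fin (q + 1) → ℝ) (k : ℕ) : ℝ :=
  ∑ j : Fin (q + 1), b j * (marsdenCoeff τ q (τ m) j k / (τ (m + 1) - τ m) ^ (j : ℕ))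

theorem IsKnotSeq.sum_localCoeff (hK : IsKnotSeq q L κ τ) (m : ℕ) (b : Fin (q + 1) → ℝ) {u : ℝ}
    (hu : u ∈ Set.Icc (0 : ℝ) 1) :
    ∑ k ∈ Finset.range L, localCoeff τ q m b k * bspline τ q k u
      = ∑ j, b j * ((u - τ m) / (τ (m + 1) - τ m)) ^ (j : ℕ) := by
  simp only [localCoeff, Finset.sum_mul]
  rw [Finset.sum_comm]
  refine Finset.sum_congr rfl fun j _ => ?_
  rw [div_pow, ← hK.sum_marsdenCoeff hu (τ m) (Nat.lt_succ_iff.1 j.2), Finset.sum_div,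
    Finset.mul_sum]
  exact Finset.sum_congr rfl fun k _ => by ring

theorem left_mem_knotPiece {m a : ℕ} (hm : τ m < τ (m + 1)) :
    τ m + (2 * a) / (2 * q + 2) * (τ (m + 1) - τ m) ∈ knotPiece τ q m a := by
  have hg := sub_pos.2 hm
  refine Set.left_mem_Icc.2 ?_
  gcongr
  linarith

theorem left_mem_piece (q a : ℕ) : (2 * a : ℝ) / (2 * q + 2) ∈ piece q a := by
  refine Set.left_mem_Icc.2 ?_
  gcongr
  linarith

/-- Local stability of the B-spline basis. -/
theorem exists_stability_bound (q : ℕ) {κ : ℝ} (hκ : 1 ≤ κ) :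
    ∃ C : ℝ, 0 < C ∧ ∀ (L : ℕ) (τ : ℕ → ℝ), IsKnotSeq q L κ τ → ∀ m, q ≤ m → m < L →
      ∀ (α : ℕ → ℝ) (x : Fin (q + 1) → ℝ), (∀ a : Fin (q + 1), x a ∈ knotPiece τ q m a) →
      ∀ k, m ≤ k + q → k ≤ m →
        α k ^ 2 ≤ C * ∑ a, (∑ k ∈ Finset.range L, α k * bspline τ q k (x a)) ^ 2 := by
  obtain ⟨C, hC, hV⟩ := exists_vandermonde_bound q
  have hκ0 : 0 < κ := by linarith
  refine ⟨(q + 1) * ((q + 1) * (C * ((q * κ + 1) ^ q) ^ 2)), by positivity, ?_⟩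
  intro L τ hK m hqm hm α x hx k hk1 hk2
  have hlt := hK.strict m hqm hm
  set h := τ (m + 1) - τ m with hh
  have hg : 0 < h := sub_pos.2 hlt
  have hxm : ∀ a : Fin (q + 1), x a ∈ Set.Ico (τ m) (τ (m + 1)) := fun a =>
    knotPiece_subset_Ico (Nat.lt_succ_iff.1 a.2) hlt (hx a)
  have hx01 : ∀ a : Fin (q + 1), x a ∈ Set.Icc (0 : ℝ) 1 := fun a =>
    ⟨(hK.mem_Icc m).1.trans (hxm a).1, (hxm a).2.le.trans (hK.mem_Icc _).2⟩
  have hact : ∀ a, Active τ m (x a) := fun a => hK.active_of_mem_Ico (hxm a)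
  -- `T` sends a polynomial on the `m`-th interval to its B-spline coefficients in the window `m -
  -- q, …, m`. It is injective because values determine the polynomial, hence surjective: the window
  -- of `α` comes from a polynomial, to which the Vandermonde bound applies.
  let T : (Fin (q + 1) → ℝ) →ₗ[ℝ] (Fin (q + 1) → ℝ) :=
    { toFun := fun b i => localCoeff τ q m b (m - q + i)
      map_add' := fun b c => by
        funext i; simp only [localCoeff, Pi.add_apply, add_mul, Finset.sum_add_distrib]
      map_smul' := fun c b => by
        funext i
        simp only [localCoeff, Pi.smul_apply, smul_eq_mul, mul_assoc, Finset.mul_sum,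
          RingHom.id_apply] }
  have hT : ∀ (b : Fin (q + 1) → ℝ) a, ∑ j, b j * ((x a - τ m) / h) ^ (j : ℕ)
      = ∑ i : Fin (q + 1), T b i * bspline τ q (m - q + i) (x a) := fun b a => by
    rw [← hK.sum_localCoeff m b (hx01 a), (hact a).sum_eq_window hqm hm]; rfl
  have hinj : Function.Injective T := by
    rw [injective_iff_map_eq_zero]
    intro b hb
    funext j
    have h1 := hV b (fun a => (x a - τ m) / h) (fun a => scaled_mem_piece hlt (hx a)) j
    simp only [hT, hb, Pi.zero_apply, zero_mul, Finset.sum_const_zero] at h1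
    simp only [ne_eq, OfNat.ofNat_ne_zero, not_false_eq_true, zero_pow, Finset.sum_const_zero,
      mul_zero] at h1
    exact pow_eq_zero_iff two_ne_zero |>.1 (le_antisymm h1 (sq_nonneg _))
  obtain ⟨b, hb⟩ := LinearMap.injective_iff_surjective.1 hinj fun i => α (m - q + i)
  have hb' : ∀ i : Fin (q + 1), localCoeff τ q m b (m - q + i) = α (m - q + i) :=
    fun i => congrFun hb i
  have hval : ∀ a, ∑ k ∈ Finset.range L, α k * bspline τ q k (x a)
      = ∑ j, b j * ((x a - τ m) / h) ^ (j : ℕ) := fun a => by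
    rw [hT, (hact a).sum_eq_window hqm hm, hb]
  simp only [hval]
  set S := ∑ a, (∑ j, b j * ((x a - τ m) / h) ^ (j : ℕ)) ^ 2 with hS
  have hbj : ∀ j, b j ^ 2 ≤ C * S := fun j =>
    hV b (fun a => (x a - τ m) / h) (fun a => scaled_mem_piece hlt (hx a)) j
  have hαk : α k = localCoeff τ q m b k := by
    have := hb' ⟨k - (m - q), by omega⟩
    simp only at this
    rw [show m - q + (k - (m - q)) = k by omega] at this
    exact this.symm
  -- The knots entering the coefficient are within `q` gaps of `τ m`, so the powers of `h` cancel.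
  -- The `+ 1` makes the base at least `1`, allowing the exponent `j` to be raised to `q`.
  have hco : ∀ j : Fin (q + 1), (marsdenCoeff τ q (τ m) j k / h ^ (j : ℕ)) ^ 2
      ≤ ((q * κ + 1) ^ q) ^ 2 := by
    intro j
    have hj := Nat.lt_succ_iff.1 j.2
    rw [← sq_abs, abs_div, abs_of_pos (pow_pos hg _)]
    gcongr
    rw [div_le_iff₀ (pow_pos hg _)]
    have h1 := abs_marsdenCoeff_le (τ := τ) (ξ := τ m) (k := k) (R := q * (κ * h)) hj fun i hi =>
      hK.abs_sub_le hκ hqm hm (by omega) (by omega)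
    refine h1.trans ?_
    rw [← mul_assoc, mul_pow]
    gcongr
    calc (q * κ) ^ (j : ℕ) ≤ (q * κ + 1) ^ (j : ℕ) := by gcongr; linarith
      _ ≤ (q * κ + 1) ^ q := pow_le_pow_right₀ (by nlinarith [show (0 : ℝ) ≤ q * κ by positivity]) hj
  rw [hαk, localCoeff]
  refine sq_sum_le_card_mul_sum_sq.trans ?_
  simp only [Finset.card_univ, Fintype.card_fin, Nat.cast_add, Nat.cast_one]
  rw [mul_assoc]
  gcongr
  have hSn : 0 ≤ S := Finset.sum_nonneg fun _ _ => sq_nonneg _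
  calc _ ≤ ∑ _j : Fin (q + 1), C * S * ((q * κ + 1) ^ q) ^ 2 :=
        Finset.sum_le_sum fun j _ => by
          rw [mul_pow]
          exact mul_le_mul (hbj j) (hco j) (sq_nonneg _) (by positivity)
    _ = _ := by
        rw [Finset.sum_const, nsmul_eq_mul]; simp; ring

/-- Local interpolation by splines. -/
theorem IsKnotSeq.exists_interpolant (hK : IsKnotSeq q L κ τ) {m : ℕ} (hqm : q ≤ m) (hm : m < L)
    (y : Fin (q + 1) → ℝ) : ∃ β : ℕ → ℝ, ∀ a : Fin (q + 1),
      ∑ k ∈ Finset.range L, β k *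
        bspline τ q k (τ m + (2 * (a : ℕ)) / (2 * q + 2) * (τ (m + 1) - τ m)) = y a := by
  obtain ⟨C, hC, hV⟩ := exists_vandermonde_bound q
  have hlt := hK.strict m hqm hm
  have hg := sub_pos.2 hlt
  let z : Fin (q + 1) → ℝ := fun a => (2 * (a : ℕ)) / (2 * q + 2)
  let S : (Fin (q + 1) → ℝ) →ₗ[ℝ] (Fin (q + 1) → ℝ) :=
    { toFun := fun b a => ∑ j, b j * z a ^ (j : ℕ)
      map_add' := fun b c => by
        funext i; simp only [Pi.add_apply, add_mul, Finset.sum_add_distrib]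
      map_smul' := fun c b => by
        funext i
        simp only [Pi.smul_apply, smul_eq_mul, mul_assoc, Finset.mul_sum, RingHom.id_apply] }
  have hinj : Function.Injective S := by
    rw [injective_iff_map_eq_zero]
    intro b hb
    funext j
    have h1 := hV b z (fun a => left_mem_piece q a) j
    have h2 : ∀ a, ∑ j, b j * z a ^ (j : ℕ) = 0 := fun a => congrFun hb a
    simp only [h2] at h1
    simp only [ne_eq, OfNat.ofNat_ne_zero, not_false_eq_true, zero_pow, Finset.sum_const_zero,
      mul_zero] at h1
    exact pow_eq_zero_iff two_ne_zero |>.1 (le_antisymm h1 (sq_nonneg _))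
  -- Uniqueness of polynomial interpolation at `q + 1` distinct nodes gives existence.
  obtain ⟨b, hb⟩ := LinearMap.injective_iff_surjective.1 hinj y
  refine ⟨localCoeff τ q m b, fun a => ?_⟩
  have hmem := knotPiece_subset_Ico (Nat.lt_succ_iff.1 a.2) hlt
    (left_mem_knotPiece (q := q) (a := a) hlt)
  rw [hK.sum_localCoeff m b
    ⟨(hK.mem_Icc m).1.trans hmem.1, hmem.2.le.trans (hK.mem_Icc _).2⟩, ← hb]
  refine Finset.sum_congr rfl fun j _ => ?_
  rw [add_sub_cancel_left, mul_div_cancel_right₀ _ hg.ne']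

/-- Spline approximation of smooth functions. -/
theorem exists_approximation_bound (q t : ℕ) {r D H κ : ℝ} (hr : 0 < r) (hq : t ≤ q)
    (hκ : 1 ≤ κ) :
    ∃ C : ℝ, 0 < C ∧ ∀ (L : ℕ) (τ : ℕ → ℝ), IsKnotSeq q L κ τ → ∀ f ∈ holderClass t r D H,
      ∃ α : ℕ → ℝ, ∀ u ∈ Set.Icc (0 : ℝ) 1,
        |f u - ∑ k ∈ Finset.range L, α k * bspline τ q k u| ≤ C * (L : ℝ) ^ (-(t + r)) := by
  obtain ⟨C, hC, hS⟩ := exists_stability_bound q hκ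
  have hκ0 : 0 < κ := by linarith
  set G : ℝ := (q + 1) * (κ * (κ * (q + 1))) with hG
  have hG0 : 0 < G := by positivity
  refine ⟨Real.sqrt (C * (q + 1)) * (|H| * G ^ (t + r)) + 1, by positivity, ?_⟩
  rintro L τ hK f ⟨hf, -, hH⟩
  have hL : (0 : ℝ) < L := by
    have := hK.lt_card
    exact_mod_cast (by omega : 0 < L)
  have hloc : ∀ m, ∃ β : ℕ → ℝ, q ≤ m → m < L → ∀ a : Fin (q + 1),
      ∑ k ∈ Finset.range L, β k *
        bspline τ q k (τ m + (2 * (a : ℕ)) / (2 * q + 2) * (τ (m + 1) - τ m))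
        = f (τ m + (2 * (a : ℕ)) / (2 * q + 2) * (τ (m + 1) - τ m)) := by
    intro m
    by_cases h : q ≤ m ∧ m < L
    · obtain ⟨β, hβ⟩ := hK.exists_interpolant h.1 h.2 fun a =>
        f (τ m + (2 * (a : ℕ)) / (2 * q + 2) * (τ (m + 1) - τ m))
      exact ⟨β, fun _ _ => hβ⟩
    · exact ⟨0, fun h1 h2 => absurd ⟨h1, h2⟩ h⟩
  choose β hβ using hloc
  -- A quasi-interpolant: the `k`-th coefficient is taken from the interpolant of `f` on the knot
  -- interval `max k q`, a nonempty interval in the support of the `k`-th spline.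
  refine ⟨fun k => β (max k q) k, fun u hu => ?_⟩
  obtain ⟨m, hqm, hm, hact⟩ := hK.exists_active hu
  set c : ℕ → ℝ := fun j => iteratedDerivWithin j f (Set.Icc 0 1) u / j.factorial with hc
  -- These are the B-spline coefficients of the Taylor polynomial at `u`, available because `t ≤ q`.
  -- At the nodes, the splines with coefficients `β M` and `π` differ by the Taylor remainder;
  -- stability carries this bound over to the coefficients.
  set π : ℕ → ℝ := fun k => ∑ j ∈ Finset.range (t + 1), c j * marsdenCoeff τ q u j k with hπ
  have hP : ∀ y ∈ Set.Icc (0 : ℝ) 1, ∑ k ∈ Finset.range L, π k * bspline τ q k y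
      = ∑ j ∈ Finset.range (t + 1), c j * (y - u) ^ j := by
    intro y hy
    simp only [hπ, Finset.sum_mul]
    rw [Finset.sum_comm]
    refine Finset.sum_congr rfl fun j hj => ?_
    rw [← hK.sum_marsdenCoeff hy u (show j ≤ q by rw [Finset.mem_range] at hj; omega),
      Finset.mul_sum]
    exact Finset.sum_congr rfl fun k _ => by ring
  have hrem : ∀ y ∈ Set.Icc (0 : ℝ) 1, |f y - ∑ k ∈ Finset.range L, π k * bspline τ q k y|
      ≤ |H| * |y - u| ^ (t + r) := by
    intro y hy
    rw [hP y hy]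
    refine (abs_sub_taylor_le hr t f hf hH hu hy).trans ?_
    gcongr
    exact le_abs_self H
  have hcoef : ∀ k, m ≤ k + q → k ≤ m → |β (max k q) k - π k|
      ≤ Real.sqrt (C * (q + 1)) * (|H| * G ^ (t + r)) * (L : ℝ) ^ (-(t + r)) := by
    intro k hk1 hk2
    set M := max k q with hM
    have hqM : q ≤ M := le_max_right _ _
    have hML : M < L := by omega
    have hlt := hK.strict M hqM hML
    have h1 := hS L τ hK M hqM hML (fun i => β M i - π i)
      (fun a => τ M + (2 * (a : ℕ)) / (2 * q + 2) * (τ (M + 1) - τ M))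
      (fun a => left_mem_knotPiece hlt) k (by omega) (by omega)
    have h2 : ∀ a : Fin (q + 1), (∑ i ∈ Finset.range L, (β M i - π i) *
        bspline τ q i (τ M + (2 * (a : ℕ)) / (2 * q + 2) * (τ (M + 1) - τ M))) ^ 2
        ≤ (|H| * (G / L) ^ (t + r)) ^ 2 := by
      intro a
      have hmem := knotPiece_subset_Ico (Nat.lt_succ_iff.1 a.2) hlt
        (left_mem_knotPiece (q := q) (a := a) hlt)
      set x := τ M + (2 * (a : ℕ)) / (2 * q + 2) * (τ (M + 1) - τ M) with hx
      have hx01 : x ∈ Set.Icc (0 : ℝ) 1 :=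
        ⟨(hK.mem_Icc M).1.trans hmem.1, hmem.2.le.trans (hK.mem_Icc _).2⟩
      simp only [sub_mul, Finset.sum_sub_distrib]
      rw [hβ M hqM hML a, ← sq_abs]
      gcongr
      refine (hrem x hx01).trans ?_
      gcongr
      -- The node `x` and the point `u` both lie within `q + 1` consecutive gaps starting at `τ (min
      -- m M)`, hence at distance at most `G / L`.
      have hlow : τ (min m M) ≤ x ∧ τ (min m M) ≤ u :=
        ⟨(hK.monotone (min_le_right _ _)).trans hmem.1,
          (hK.monotone (min_le_left _ _)).trans hact.left⟩
      have hupp : x ≤ τ (min m M + (q + 1)) ∧ u ≤ τ (min m M + (q + 1)) :=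
        ⟨hmem.2.le.trans (hK.monotone (by omega)), hact.right.trans (hK.monotone (by omega))⟩
      have hgap := hK.sub_le hκ hqm hm (min m M) (q + 1)
      have hgl := hK.mul_gap_le hqm hm
      have hfin : ((q + 1 : ℕ) : ℝ) * (κ * (τ (m + 1) - τ m)) ≤ G / L := by
        rw [le_div_iff₀ hL, hG]
        push_cast
        calc _ = (q + 1) * (κ * (L * (τ (m + 1) - τ m))) := by ring
          _ ≤ _ := by gcongr
      rw [abs_sub_le_iff]
      constructor <;> linarith [hlow.1, hlow.2, hupp.1, hupp.2]
    have h3 : (β M k - π k) ^ 2 ≤ C * ((q + 1) * (|H| * (G / L) ^ (t + r)) ^ 2) := by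
      refine h1.trans ?_
      gcongr
      refine (Finset.sum_le_sum fun a _ => h2 a).trans (le_of_eq ?_)
      simp
    rw [← mul_assoc] at h3
    have h4 := Real.sqrt_le_sqrt h3
    rw [Real.sqrt_sq_eq_abs, Real.sqrt_mul (by positivity), Real.sqrt_sq (by positivity),
      Real.div_rpow hG0.le hL.le, div_eq_mul_inv, ← Real.rpow_neg hL.le] at h4
    refine h4.trans (le_of_eq (by ring))
  have hu0 : ∑ k ∈ Finset.range L, π k * bspline τ q k u = f u := by
    have := hrem u hu
    rw [sub_self, abs_zero, Real.zero_rpow (by positivity), mul_zero] at this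
    have := abs_eq_zero.1 (le_antisymm this (abs_nonneg _))
    linarith
  rw [← hu0, ← Finset.sum_sub_distrib]
  set B := Real.sqrt (C * (q + 1)) * (|H| * G ^ (t + r)) * (L : ℝ) ^ (-(t + r)) with hB
  calc _ ≤ ∑ k ∈ Finset.range L, |π k * bspline τ q k u - β (max k q) k * bspline τ q k u| :=
        Finset.abs_sum_le_sum_abs _ _
    _ ≤ ∑ k ∈ Finset.range L, B * bspline τ q k u := by
        refine Finset.sum_le_sum fun k _ => ?_
        by_cases hk : m ≤ k + q ∧ k ≤ m
        · rw [← sub_mul, abs_mul, abs_of_nonneg (hK.bspline_nonneg q k u), abs_sub_comm]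
          exact mul_le_mul_of_nonneg_right (hcoef k hk.1 hk.2) (hK.bspline_nonneg q k u)
        · rw [hact.bspline_eq_zero q k (by omega)]; simp
    _ = B := by rw [← Finset.mul_sum, hK.sum_bspline hu, mul_one]
    _ ≤ _ := by
        rw [hB]
        gcongr
        linarith

/-! ### The Gram matrix of an even design and the deterministic error bound -/

/-- The number of sample points of class `l` in the set `J`. -/
noncomputable def classCount {N : ℕ} (U : Fin N → ℝ) (Y : Fin N → Fin 2) (l : Fin 2)
    (J : Set ℝ) : ℝ :=
  ∑ i with Y i = l, J.indicator (fun _ => (1 : ℝ)) (U i)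

/-- The design points of class `l` are spread evenly, up to constants, over the knot intervals. -/
structure EvenDesign (q L : ℕ) (τ : ℕ → ℝ) {N : ℕ} (U : Fin N → ℝ) (Y : Fin N → Fin 2) (l : Fin 2)
    (c₀ C₀ s : ℝ) : Prop where
  lower : ∀ m, q ≤ m → m < L → ∀ a ≤ q, c₀ * s / L ≤ classCount U Y l (knotPiece τ q m a)
  upper : ∀ m, q ≤ m → m < L → classCount U Y l (Set.Icc (τ m) (τ (m + 1))) ≤ C₀ * s / L

variable {q L N : ℕ} {κ c₀ C₀ s : ℝ} {τ : ℕ → ℝ} {U : Fin N → ℝ} {Y : Fin N → Fin 2} {l : Fin 2}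

theorem IsKnotSeq.bspline_le_one (hK : IsKnotSeq q L κ τ) {k : ℕ} (hk : k < L) (u : ℝ) :
    bspline τ q k u ≤ 1 := by
  by_cases hu : u ∈ Set.Icc (0 : ℝ) 1
  · rw [← hK.sum_bspline hu]
    exact Finset.single_le_sum (f := fun k => bspline τ q k u)
      (fun i _ => hK.bspline_nonneg q i u) (Finset.mem_range.2 hk)
  · rw [hK.bspline_eq_zero_of_notMem hu]; exact zero_le_one

/-- The support meets at most `q + 1` nondegenerate knot intervals. The filter drops the degenerate
ones at the ends, for which `EvenDesign` says nothing. -/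
theorem IsKnotSeq.bspline_le_indicator (hK : IsKnotSeq q L κ τ) {k : ℕ} (hk : k < L) (u : ℝ) :
    bspline τ q k u ≤ ∑ e ∈ (Finset.range (q + 1)).filter (fun e => q ≤ k + e ∧ k + e < L),
      (Set.Icc (τ (k + e)) (τ (k + e + 1))).indicator (fun _ => (1 : ℝ)) u := by
  have hn : 0 ≤ ∑ e ∈ (Finset.range (q + 1)).filter (fun e => q ≤ k + e ∧ k + e < L),
      (Set.Icc (τ (k + e)) (τ (k + e + 1))).indicator (fun _ => (1 : ℝ)) u :=
    Finset.sum_nonneg fun _ _ => Set.indicator_nonneg (fun _ _ => zero_le_one) _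
  by_cases hu : u ∈ Set.Icc (0 : ℝ) 1
  · obtain ⟨m, hqm, hm, hact⟩ := hK.exists_active hu
    by_cases hkm : m < k ∨ k + q < m
    · rwa [hact.bspline_eq_zero q k hkm]
    · refine (hK.bspline_le_one hk u).trans ?_
      have hmem : m - k ∈ (Finset.range (q + 1)).filter (fun e => q ≤ k + e ∧ k + e < L) := by
        rw [Finset.mem_filter, Finset.mem_range]; omega
      refine le_trans (le_of_eq ?_) (Finset.single_le_sum
        (f := fun e => (Set.Icc (τ (k + e)) (τ (k + e + 1))).indicator (fun _ => (1 : ℝ)) u)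
        (fun _ _ => Set.indicator_nonneg (fun _ _ => zero_le_one) _) hmem)
      rw [show k + (m - k) = m by omega, Set.indicator_of_mem (Set.mem_Icc.2 ⟨hact.left, hact.right⟩)]
  · rwa [hK.bspline_eq_zero_of_notMem hu]

theorem EvenDesign.sum_bspline_le (hE : EvenDesign q L τ U Y l c₀ C₀ s) (hK : IsKnotSeq q L κ τ)
    (hC₀ : 0 ≤ C₀) (hs : 0 ≤ s) {k : ℕ} (hk : k < L) :
    ∑ i with Y i = l, bspline τ q k (U i) ≤ (q + 1) * (C₀ * s / L) := by
  calc _ ≤ ∑ i with Y i = l, ∑ e ∈ (Finset.range (q + 1)).filter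
        (fun e => q ≤ k + e ∧ k + e < L),
        (Set.Icc (τ (k + e)) (τ (k + e + 1))).indicator (fun _ => (1 : ℝ)) (U i) :=
      Finset.sum_le_sum fun i _ => hK.bspline_le_indicator hk _
    _ = ∑ e ∈ (Finset.range (q + 1)).filter (fun e => q ≤ k + e ∧ k + e < L),
        classCount U Y l (Set.Icc (τ (k + e)) (τ (k + e + 1))) := Finset.sum_comm
    _ ≤ ∑ e ∈ (Finset.range (q + 1)).filter (fun e => q ≤ k + e ∧ k + e < L), C₀ * s / L := by
        refine Finset.sum_le_sum fun e he => ?_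
        rw [Finset.mem_filter] at he
        exact hE.upper _ he.2.1 he.2.2
    _ ≤ ∑ e ∈ Finset.range (q + 1), C₀ * s / L :=
        Finset.sum_le_sum_of_subset_of_nonneg (Finset.filter_subset _ _)
          fun _ _ _ => by positivity
    _ = _ := by rw [Finset.sum_const, Finset.card_range, nsmul_eq_mul]; push_cast; rfl

theorem gram_apply (i j : Fin L) :
    gram q L τ U Y l i j = ∑ x with Y x = l, basis q L τ (U x) i * basis q L τ (U x) j := by
  rw [gram, Matrix.sum_apply]
  rfl

theorem gram_mulVec (w : Fin L → ℝ) (k : Fin L) : (gram q L τ U Y l).mulVec w k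
    = ∑ x with Y x = l, basis q L τ (U x) k * dotProduct (basis q L τ (U x)) w := by
  simp only [Matrix.mulVec, dotProduct, gram_apply, Finset.sum_mul, Finset.mul_sum]
  rw [Finset.sum_comm]
  exact Finset.sum_congr rfl fun x _ => Finset.sum_congr rfl fun j _ => by ring

theorem basis_mul_basis (hK : IsKnotSeq q L κ τ) (u : ℝ) (i j : Fin L) :
    0 ≤ basis q L τ u i * basis q L τ u j ∧
      basis q L τ u i * basis q L τ u j ≤ L * bspline τ q i u := by
  have h1 := hK.bspline_nonneg q i u
  have h2 := hK.bspline_nonneg q j u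
  have h3 := hK.bspline_le_one j.2 u
  have h4 := Real.mul_self_sqrt (Nat.cast_nonneg (α := ℝ) L)
  have h5 : basis q L τ u i * basis q L τ u j = L * (bspline τ q i u * bspline τ q j u) := by
    simp only [basis]
    linear_combination (bspline τ q i u * bspline τ q j u) * h4
  rw [h5]
  refine ⟨by positivity, ?_⟩
  gcongr
  exact mul_le_of_le_one_right h1 h3

theorem EvenDesign.gram_apply_le (hE : EvenDesign q L τ U Y l c₀ C₀ s) (hK : IsKnotSeq q L κ τ)
    (hC₀ : 0 ≤ C₀) (hs : 0 ≤ s) (i j : Fin L) :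
    |gram q L τ U Y l i j| ≤ (q + 1) * C₀ * s := by
  have hL : (0 : ℝ) < L := by exact_mod_cast (Nat.zero_le _).trans_lt i.2
  rw [gram_apply, abs_of_nonneg (Finset.sum_nonneg fun x _ => (basis_mul_basis hK (U x) i j).1)]
  calc _ ≤ ∑ x with Y x = l, L * bspline τ q i (U x) :=
        Finset.sum_le_sum fun x _ => (basis_mul_basis hK (U x) i j).2
    _ = L * ∑ x with Y x = l, bspline τ q i (U x) := by rw [Finset.mul_sum]
    _ ≤ L * ((q + 1) * (C₀ * s / L)) := by
        gcongr; exact hE.sum_bspline_le hK hC₀ hs i.2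
    _ = _ := by field_simp

theorem gram_band (hK : IsKnotSeq q L κ τ) (i j : Fin L)
    (hij : ¬ ((i : ℕ) ≤ j + q ∧ (j : ℕ) ≤ i + q)) : gram q L τ U Y l i j = 0 := by
  rw [gram_apply]
  refine Finset.sum_eq_zero fun x _ => ?_
  simp only [basis]
  by_cases hu : U x ∈ Set.Icc (0 : ℝ) 1
  · obtain ⟨m, hqm, hm, hact⟩ := hK.exists_active hu
    by_cases hi : m < i ∨ i + q < m
    · rw [hact.bspline_eq_zero q i hi]; ring
    · rw [hact.bspline_eq_zero q j (by omega)]; ring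
  · rw [hK.bspline_eq_zero_of_notMem hu]; ring

/-- Take the sample point in `J` where `g` is smallest. The stability bound, which needs one point
per piece, can thus be compared with sums over the design. -/
theorem exists_piece_point (hlow : 0 < c₀ * s / L) {J : Set ℝ}
    (h : c₀ * s / L ≤ classCount U Y l J) (g : ℝ → ℝ) (hg : ∀ x, 0 ≤ g x) :
    ∃ x ∈ J, c₀ * s / L * g x ≤ ∑ i with Y i = l, J.indicator g (U i) := by
  classical
  set F := (Finset.univ.filter fun i => Y i = l).filter fun i => U i ∈ J with hF
  have hcount : ∀ f : ℝ → ℝ, ∑ i with Y i = l, J.indicator f (U i) = ∑ i ∈ F, f (U i) := by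
    intro f
    rw [hF, Finset.sum_filter (fun i => U i ∈ J)]
    exact Finset.sum_congr rfl fun i _ => by rw [Set.indicator_apply]
  have hc : classCount U Y l J = F.card := by rw [classCount, hcount]; simp
  have hne : F.Nonempty := by
    rw [← Finset.card_pos]
    have : (0 : ℝ) < F.card := by rw [← hc]; linarith
    exact_mod_cast this
  obtain ⟨i, hi, hmin⟩ := Finset.exists_min_image F (fun i => g (U i)) hne
  refine ⟨U i, (Finset.mem_filter.1 hi).2, ?_⟩
  rw [hcount]
  calc _ ≤ F.card * g (U i) := by
        rw [← hc]; exact mul_le_mul_of_nonneg_right h (hg _)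
    _ = ∑ _j ∈ F, g (U i) := by rw [Finset.sum_const, nsmul_eq_mul]
    _ ≤ _ := Finset.sum_le_sum fun j hj => hmin j hj

theorem IsKnotSeq.eq_of_mem_Ico (hK : IsKnotSeq q L κ τ) {m m' : ℕ} {u : ℝ}
    (h : u ∈ Set.Ico (τ m) (τ (m + 1))) (h' : u ∈ Set.Ico (τ m') (τ (m' + 1))) : m = m' := by
  rcases lt_trichotomy m m' with hlt | he | hlt
  · exact absurd (h.2.trans_le ((hK.monotone (show m + 1 ≤ m' from hlt)).trans h'.1)) (lt_irrefl _)
  · exact he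
  · exact absurd (h'.2.trans_le ((hK.monotone (show m' + 1 ≤ m from hlt)).trans h.1)) (lt_irrefl _)

/-- At most `q + 1` indices `k` share the interval `max k q`, and different intervals are disjoint.
-/
theorem IsKnotSeq.sum_indicator_knotPiece_le (hK : IsKnotSeq q L κ τ) {a : ℕ} (ha : a ≤ q)
    (g : ℝ → ℝ) (hg : ∀ x, 0 ≤ g x) (u : ℝ) :
    ∑ k ∈ Finset.range L, (knotPiece τ q (max k q) a).indicator g u ≤ (q + 1) * g u := by
  have hsub : ∀ k < L, u ∈ knotPiece τ q (max k q) a →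
      u ∈ Set.Ico (τ (max k q)) (τ (max k q + 1)) := fun k hk h => by
    have := hK.lt_card
    exact knotPiece_subset_Ico ha (hK.strict _ (le_max_right _ _) (by omega)) h
  by_cases hex : ∃ k < L, u ∈ knotPiece τ q (max k q) a
  · obtain ⟨k₀, hk₀, hu⟩ := hex
    set M := max k₀ q with hM
    calc _ ≤ ∑ k ∈ Finset.range L, if k ∈ Finset.Icc (M - q) M then g u else 0 := by
          refine Finset.sum_le_sum fun k hk => ?_
          rw [Finset.mem_range] at hk
          by_cases hmem : u ∈ knotPiece τ q (max k q) a
          · have := hK.eq_of_mem_Ico (hsub k hk hmem) (hsub k₀ hk₀ hu)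
            rw [if_pos (by rw [Finset.mem_Icc]; omega), Set.indicator_of_mem hmem]
          · rw [Set.indicator_of_notMem hmem]
            split_ifs
            · exact hg u
            · exact le_rfl
      _ = ((Finset.range L).filter (· ∈ Finset.Icc (M - q) M)).card * g u := by
          rw [← Finset.sum_filter, Finset.sum_const, nsmul_eq_mul]
      _ ≤ _ := by
          refine mul_le_mul_of_nonneg_right ?_ (hg u)
          have h1 : ((Finset.range L).filter (· ∈ Finset.Icc (M - q) M)).card
              ≤ (Finset.Icc (M - q) M).card :=
            Finset.card_le_card fun x hx => (Finset.mem_filter.1 hx).2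
          rw [Nat.card_Icc] at h1
          have h2 : ((Finset.range L).filter (· ∈ Finset.Icc (M - q) M)).card ≤ q + 1 := by omega
          exact_mod_cast h2
  · push Not at hex
    rw [Finset.sum_eq_zero fun k hk => Set.indicator_of_notMem (hex k (Finset.mem_range.1 hk)) _]
    exact mul_nonneg (by positivity) (hg u)

theorem sum_mul_gram_mul (x : Fin L → ℝ) :
    ∑ i, ∑ j, x i * gram q L τ U Y l i j * x j
      = ∑ a with Y a = l, dotProduct (basis q L τ (U a)) x ^ 2 := by
  have h : ∀ i, ∑ j, x i * gram q L τ U Y l i j * x j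
      = ∑ a with Y a = l, (basis q L τ (U a) i * x i) * dotProduct (basis q L τ (U a)) x := by
    intro i
    have := gram_mulVec (q := q) (τ := τ) (U := U) (Y := Y) (l := l) x i
    simp only [mul_assoc]
    rw [← Finset.mul_sum]
    change x i * (gram q L τ U Y l).mulVec x i = _
    rw [this, Finset.mul_sum]
    exact Finset.sum_congr rfl fun a _ => by ring
  simp only [h]
  rw [Finset.sum_comm]
  refine Finset.sum_congr rfl fun a _ => ?_
  rw [← Finset.sum_mul, sq]
  rfl

/-- The Gram matrix of an evenly spread design is well conditioned. -/
theorem exists_gram_lower_bound (q : ℕ) {κ c₀ : ℝ} (hκ : 1 ≤ κ) (hc₀ : 0 < c₀) :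
    ∃ c : ℝ, 0 < c ∧ ∀ (L : ℕ) (τ : ℕ → ℝ), IsKnotSeq q L κ τ → ∀ (N : ℕ) (U : Fin N → ℝ)
      (Y : Fin N → Fin 2) (l : Fin 2) (C₀ s : ℝ), 0 < s → EvenDesign q L τ U Y l c₀ C₀ s →
      ∀ x : Fin L → ℝ, c * s * ∑ i, x i ^ 2 ≤ ∑ i, ∑ j, x i * gram q L τ U Y l i j * x j := by
  obtain ⟨C, hC, hS⟩ := exists_stability_bound q hκ
  -- One factor `q + 1` counts the pieces of an interval, the other the coefficients assigned to the
  -- same interval.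
  refine ⟨c₀ / (C * (q + 1) ^ 2), by positivity, ?_⟩
  intro L τ hK N U Y l C₀ s hs hE x
  have hLn : 0 < L := by have := hK.lt_card; omega
  have hL : (0 : ℝ) < L := by exact_mod_cast hLn
  have hlow : 0 < c₀ * s / L := by positivity
  set α : ℕ → ℝ := fun k => if h : k < L then x ⟨k, h⟩ else 0 with hα
  set g : ℝ → ℝ := fun u => (∑ k ∈ Finset.range L, α k * bspline τ q k u) ^ 2 with hg
  have hg0 : ∀ u, 0 ≤ g u := fun u => sq_nonneg _
  have hquad : ∑ i, ∑ j, x i * gram q L τ U Y l i j * x j = L * ∑ a with Y a = l, g (U a) := by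
    rw [sum_mul_gram_mul, Finset.mul_sum]
    refine Finset.sum_congr rfl fun a _ => ?_
    have : dotProduct (basis q L τ (U a)) x
        = Real.sqrt L * ∑ k ∈ Finset.range L, α k * bspline τ q k (U a) := by
      rw [← Fin.sum_univ_eq_sum_range (fun k => α k * bspline τ q k (U a)), Finset.mul_sum]
      refine Finset.sum_congr rfl fun k _ => ?_
      simp only [basis, hα, k.2, dif_pos]
      ring
    rw [this, mul_pow, Real.sq_sqrt hL.le]
  have hk : ∀ k < L, c₀ * s / L * α k ^ 2 ≤ C * ∑ a : Fin (q + 1),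
      ∑ i with Y i = l, (knotPiece τ q (max k q) a).indicator g (U i) := by
    intro k hk
    have hqM : q ≤ max k q := le_max_right _ _
    have hML : max k q < L := by have := hK.lt_card; omega
    have hp : ∀ a : Fin (q + 1), ∃ y ∈ knotPiece τ q (max k q) a, c₀ * s / L * g y ≤
        ∑ i with Y i = l, (knotPiece τ q (max k q) a).indicator g (U i) := fun a =>
      exists_piece_point hlow (hE.lower _ hqM hML a (Nat.lt_succ_iff.1 a.2)) g hg0
    choose y hy1 hy2 using hp
    have h1 := hS L τ hK _ hqM hML α y hy1 k (by omega) (by omega)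
    calc _ ≤ c₀ * s / L * (C * ∑ a, g (y a)) := by gcongr
      _ = C * ∑ a, c₀ * s / L * g (y a) := by rw [← Finset.mul_sum]; ring
      _ ≤ _ := by gcongr with a _; exact hy2 a
  have hsum : c₀ * s / L * ∑ i, x i ^ 2 ≤ C * ((q + 1) ^ 2 * ∑ i with Y i = l, g (U i)) := by
    have e1 : ∑ i, x i ^ 2 = ∑ k ∈ Finset.range L, α k ^ 2 := by
      rw [← Fin.sum_univ_eq_sum_range (fun k => α k ^ 2)]
      refine Finset.sum_congr rfl fun k _ => ?_
      simp only [hα, k.2, dif_pos]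
    rw [e1, Finset.mul_sum]
    calc _ ≤ ∑ k ∈ Finset.range L, C * ∑ a : Fin (q + 1),
          ∑ i with Y i = l, (knotPiece τ q (max k q) a).indicator g (U i) :=
          Finset.sum_le_sum fun k hk' => hk k (Finset.mem_range.1 hk')
      _ = C * ∑ a : Fin (q + 1), ∑ i with Y i = l, ∑ k ∈ Finset.range L,
          (knotPiece τ q (max k q) a).indicator g (U i) := by
          rw [← Finset.mul_sum, Finset.sum_comm]
          congr 1
          exact Finset.sum_congr rfl fun a _ => Finset.sum_comm
      _ ≤ C * ∑ a : Fin (q + 1), ∑ i with Y i = l, (q + 1) * g (U i) := by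
          gcongr with a _ i _
          exact hK.sum_indicator_knotPiece_le (Nat.lt_succ_iff.1 a.2) g hg0 _
      _ = _ := by
          simp only [← Finset.mul_sum, Finset.sum_const, Finset.card_univ, Fintype.card_fin,
            nsmul_eq_mul]
          push_cast; ring
  rw [hquad]
  calc _ = L / (C * (q + 1) ^ 2) * (c₀ * s / L * ∑ i, x i ^ 2) := by field_simp
    _ ≤ L / (C * (q + 1) ^ 2) * (C * ((q + 1) ^ 2 * ∑ i with Y i = l, g (U i))) := by gcongr
    _ = _ := by field_simp

/-- Deterministic error bound for the least squares spline estimator. -/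
theorem exists_estimation_bound (q t : ℕ) {r κ c₀ C₀ : ℝ} (D H : ℝ) (hr : 0 < r) (hq : t ≤ q)
    (hκ : 1 ≤ κ) (hc₀ : 0 < c₀) (hC₀ : 0 < C₀) :
    ∃ C : ℝ, 0 < C ∧ ∀ (L : ℕ) (τ : ℕ → ℝ), IsKnotSeq q L κ τ → ∀ (N : ℕ) (U : Fin N → ℝ)
      (Y : Fin N → Fin 2) (l : Fin 2) (s : ℝ), 0 < s → EvenDesign q L τ U Y l c₀ C₀ s →
      IsUnit (gram q L τ U Y l).det ∧ ∀ f ∈ holderClass t r D H, ∀ (x : Fin N → ℝ) (V : ℝ),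
        (∀ k, |∑ i with Y i = l, basis q L τ (U i) k * (x i - f (U i))| ≤ V) →
        ∀ u ∈ Set.Icc (0 : ℝ) 1,
          |dotProduct ((gram q L τ U Y l)⁻¹.mulVec (∑ i with Y i = l, x i • basis q L τ (U i)))
            (basis q L τ u) - f u| ≤ C * (Real.sqrt L * V / s + (L : ℝ) ^ (-(t + r))) := by
  obtain ⟨c, hc, hlow⟩ := exists_gram_lower_bound q hκ hc₀
  obtain ⟨CJ, hCJ, hJ⟩ := exists_approximation_bound q t (r := r) (D := D) (H := H) hr hq hκ
  -- `ρ` is the entry bound `(q + 1) * C₀ * s` divided by the coercivity constant `c * s`.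
  obtain ⟨CD, hCD, hD⟩ := exists_banded_inverse_bound q (ρ := (q + 1) * C₀ / c) (by positivity)
  refine ⟨CD / c * (1 + CJ * ((q + 1) * C₀)) + CJ, by positivity, ?_⟩
  intro L τ hK N U Y l s hs hE
  have hLn : 0 < L := by have := hK.lt_card; omega
  have hL : (0 : ℝ) < L := by exact_mod_cast hLn
  set A := gram q L τ U Y l with hA
  have hinv : ∀ (w : Fin L → ℝ) (V : ℝ), (∀ i, |A.mulVec w i| ≤ V) →
      ∀ k, |w k| ≤ CD * V / (c * s) := by
    refine hD L A (c * s) (by positivity) (fun i j => ?_) (fun i j => ?_)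
      (fun i j h => gram_band hK i j h) (fun x => hlow L τ hK N U Y l C₀ s hs hE x)
    · rw [hA, gram_apply, gram_apply]
      exact Finset.sum_congr rfl fun _ _ => mul_comm _ _
    · refine (hE.gram_apply_le hK hC₀.le hs.le i j).trans (le_of_eq ?_)
      field_simp
  -- The maximum norm bound with `V = 0` shows that the kernel is trivial.
  have hunit : IsUnit A := by
    rw [← Matrix.mulVec_injective_iff_isUnit]
    intro v w hvw
    funext k
    have h0 : A.mulVec (v - w) = 0 := by rw [Matrix.mulVec_sub]; exact sub_eq_zero.2 hvw
    have h1 := hinv (v - w) 0 (fun i => by rw [h0]; simp) k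
    simp only [mul_zero, zero_div] at h1
    exact sub_eq_zero.1 (abs_eq_zero.1 (le_antisymm h1 (abs_nonneg _)))
  have hdet : IsUnit A.det := (Matrix.isUnit_iff_isUnit_det A).1 hunit
  refine ⟨hdet, fun f hf x V hV u hu => ?_⟩
  obtain ⟨α, hα⟩ := hJ L τ hK f hf
  set R : ℝ := CJ * (L : ℝ) ^ (-(t + r)) with hR
  have hR0 : 0 ≤ R := by positivity
  have hsL : 0 < Real.sqrt L := Real.sqrt_pos.2 hL
  set β : Fin L → ℝ := fun k => α k / Real.sqrt L with hβ
  have hdot : ∀ y, dotProduct (basis q L τ y) β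
      = ∑ k ∈ Finset.range L, α k * bspline τ q k y := by
    intro y
    rw [← Fin.sum_univ_eq_sum_range (fun k => α k * bspline τ q k y)]
    refine Finset.sum_congr rfl fun k _ => ?_
    simp only [basis, hβ]
    field_simp
  have happ : ∀ y ∈ Set.Icc (0 : ℝ) 1, |f y - dotProduct (basis q L τ y) β| ≤ R := fun y hy => by
    rw [hdot]; exact hα y hy
  set a := A⁻¹.mulVec (∑ i with Y i = l, x i • basis q L τ (U i)) with ha
  -- The normal equations, with the residual from the approximant split into noise and bias.
  have hAa : ∀ k, A.mulVec (a - β) k = ∑ i with Y i = l, basis q L τ (U i) k * (x i - f (U i))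
      + ∑ i with Y i = l, basis q L τ (U i) k * (f (U i) - dotProduct (basis q L τ (U i)) β) := by
    intro k
    have h1 : A.mulVec a = ∑ i with Y i = l, x i • basis q L τ (U i) := by
      rw [ha, Matrix.mulVec_mulVec, Matrix.mul_nonsing_inv A hdet, Matrix.one_mulVec]
    rw [Matrix.mulVec_sub, Pi.sub_apply, h1, hA, gram_mulVec, Finset.sum_apply,
      ← Finset.sum_sub_distrib, ← Finset.sum_add_distrib]
    refine Finset.sum_congr rfl fun i _ => ?_
    simp only [Pi.smul_apply, smul_eq_mul]
    ring
  have hbias : ∀ k, |∑ i with Y i = l, basis q L τ (U i) k *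
      (f (U i) - dotProduct (basis q L τ (U i)) β)| ≤ R * ((q + 1) * C₀) * s / Real.sqrt L := by
    intro k
    calc _ ≤ ∑ i with Y i = l, |basis q L τ (U i) k *
          (f (U i) - dotProduct (basis q L τ (U i)) β)| := Finset.abs_sum_le_sum_abs _ _
      _ ≤ ∑ i with Y i = l, R * (Real.sqrt L * bspline τ q k (U i)) := by
          refine Finset.sum_le_sum fun i _ => ?_
          by_cases hi : U i ∈ Set.Icc (0 : ℝ) 1
          · rw [abs_mul, mul_comm]
            have hb : 0 ≤ Real.sqrt L * bspline τ q k (U i) :=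
              mul_nonneg hsL.le (hK.bspline_nonneg _ _ _)
            rw [basis, abs_of_nonneg hb]
            exact mul_le_mul_of_nonneg_right (happ _ hi) hb
          · simp [basis, hK.bspline_eq_zero_of_notMem hi]
      _ = R * Real.sqrt L * ∑ i with Y i = l, bspline τ q k (U i) := by
          rw [Finset.mul_sum]
          exact Finset.sum_congr rfl fun _ _ => by ring
      _ ≤ R * Real.sqrt L * ((q + 1) * (C₀ * s / L)) := by
          gcongr; exact hE.sum_bspline_le hK hC₀.le hs.le k.2
      _ = R * ((q + 1) * C₀) * s * (Real.sqrt L / L) := by ring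
      _ = _ := by rw [Real.sqrt_div_self', mul_one_div]
  have hw := hinv (a - β) (V + R * ((q + 1) * C₀) * s / Real.sqrt L) fun k => by
    rw [hAa]; exact (abs_add_le _ _).trans (add_le_add (hV k) (hbias k))
  set W := CD * (V + R * ((q + 1) * C₀) * s / Real.sqrt L) / (c * s) with hW
  -- The basis is nonnegative with sum `√L`, so the maximum of the coefficients is multiplied by
  -- `√L` only.
  have hfit : |dotProduct (a - β) (basis q L τ u)| ≤ Real.sqrt L * W := by
    calc _ ≤ ∑ k, |(a - β) k * basis q L τ u k| := Finset.abs_sum_le_sum_abs _ _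
      _ ≤ ∑ k : Fin L, W * (Real.sqrt L * bspline τ q k u) := by
          refine Finset.sum_le_sum fun k _ => ?_
          have hb : 0 ≤ Real.sqrt L * bspline τ q k u :=
            mul_nonneg hsL.le (hK.bspline_nonneg _ _ _)
          rw [abs_mul, basis, abs_of_nonneg hb]
          exact mul_le_mul_of_nonneg_right (hw k) hb
      _ = Real.sqrt L * W := by
          rw [← Finset.mul_sum, ← Finset.mul_sum,
            Fin.sum_univ_eq_sum_range (fun k => bspline τ q k u), hK.sum_bspline hu]
          ring
  have hsplit : dotProduct a (basis q L τ u) - f u = dotProduct (a - β) (basis q L τ u)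
      - (f u - dotProduct (basis q L τ u) β) := by
    rw [sub_dotProduct, dotProduct_comm β]; ring
  rw [hsplit]
  have hV0 : 0 ≤ V := (abs_nonneg _).trans (hV ⟨0, hLn⟩)
  have e : Real.sqrt L * W = CD / c * (Real.sqrt L * V / s + (q + 1) * C₀ * R) := by
    rw [hW]; field_simp
  calc _ ≤ Real.sqrt L * W + R := (abs_sub _ _).trans (add_le_add hfit (happ u hu))
    _ = CD / c * (Real.sqrt L * V / s) + (CD / c * (CJ * ((q + 1) * C₀)) + CJ)
          * (L : ℝ) ^ (-(t + r)) := by rw [e, hR]; ring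
    _ ≤ (CD / c * (1 + CJ * ((q + 1) * C₀)) + CJ) * (Real.sqrt L * V / s)
          + (CD / c * (1 + CJ * ((q + 1) * C₀)) + CJ) * (L : ℝ) ^ (-(t + r)) := by
        have h1 : 0 < CD / c := by positivity
        have h2 : 0 ≤ CD / c * (CJ * ((q + 1) * C₀)) := by positivity
        gcongr <;> linarith
    _ = _ := by ring

/-! ### The law of one coordinate and conditioning on the labels -/

/-- In an orthonormal eigenbasis a diagonal entry is a weighted average of the eigenvalues. This
bounds the coordinate variances by `lam1`. -/
theorem diag_le_of_eigenvalues_le {p : ℕ} {S : Matrix (Fin p) (Fin p) ℝ} (hS : S.IsHermitian)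
    {c : ℝ} (hc : ∀ i, hS.eigenvalues i ≤ c) (j : Fin p) : S j j ≤ c := by
  set b := hS.eigenvectorBasis with hb
  set x : EuclideanSpace ℝ (Fin p) := EuclideanSpace.single j 1 with hx
  set y : EuclideanSpace ℝ (Fin p) := WithLp.toLp 2 (S.mulVec (Pi.single j 1)) with hy
  have hxb : ∀ i, inner ℝ x (b i) = b i j := fun i => by
    rw [hx, EuclideanSpace.inner_single_left]; simp
  have hby : ∀ i, inner ℝ (b i) y = hS.eigenvalues i * b i j := fun i => by
    have h1 := congrFun (hS.mulVec_eigenvectorBasis i) j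
    have h2 : inner ℝ (b i) y = S.mulVec (b i) j := by
      rw [hy, Matrix.mulVec_single_one]
      simp only [PiLp.inner_apply, Matrix.mulVec, dotProduct]
      refine Finset.sum_congr rfl fun k _ => ?_
      have : S k j = S j k := by simpa using hS.apply j k
      simp [this]
    rw [h2, hb, h1]
    simp
  have h1 := b.sum_inner_mul_inner x y
  have h2 := b.sum_inner_mul_inner x x
  have hxy : inner ℝ x y = S j j := by
    rw [hx, hy, EuclideanSpace.inner_single_left]; simp
  have hxx : inner ℝ x x = (1 : ℝ) := by simp [hx]
  rw [hxy] at h1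
  rw [hxx] at h2
  rw [← h1, ← mul_one c, ← h2, Finset.mul_sum]
  refine Finset.sum_le_sum fun i _ => ?_
  rw [hby, hxb, real_inner_comm, hxb]
  nlinarith [mul_le_mul_of_nonneg_right (hc i) (sq_nonneg (b i j))]

section Law

variable {p N t : ℕ} {r lam0 lam1 D1 D2 D H M : ℝ} {m : Model p}

/-- The law of the exposure variable. -/
noncomputable def Model.exposureLaw (m : Model p) : Measure ℝ :=
  (volume.restrict (Set.Icc 0 1)).withDensity fun u => ENNReal.ofReal (m.density u)

/-- Coordinate `j` of the mean function of class `y`, set to zero off `[0,1]`. -/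
noncomputable def Model.meanCoord (m : Model p) (y : Fin 2) (j : Fin p) : ℝ → ℝ :=
  (Set.Icc (0 : ℝ) 1).indicator fun u => m.mean y u j

/-- The standard deviation function of coordinate `j`, set to zero off `[0,1]`. -/
noncomputable def Model.sdCoord (m : Model p) (j : Fin p) : ℝ → ℝ :=
  (Set.Icc (0 : ℝ) 1).indicator fun u => Real.sqrt (m.cov u j j)

theorem Model.Regular.measurable_meanCoord (hm : m.Regular t r lam0 lam1 D1 D2 D H M) (y : Fin 2)
    (j : Fin p) : Measurable (m.meanCoord y j) := by
  have hc : ContinuousOn (fun u => m.mean y u j) (Set.Icc 0 1) :=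
    (hm.mean_holder y j).1.continuousOn
  refine measurable_of_restrict_of_restrict_compl
    (measurableSet_Icc (a := (0 : ℝ)) (b := 1)) ?_ ?_
  · have h : (Set.Icc (0 : ℝ) 1).domRestrict (m.meanCoord y j)
        = (Set.Icc (0 : ℝ) 1).domRestrict fun u => m.mean y u j := by
      funext x
      simp [Model.meanCoord, Set.domRestrict_apply]
    rw [h]
    exact hc.domRestrict.measurable
  · have h : (Set.Icc (0 : ℝ) 1)ᶜ.domRestrict (m.meanCoord y j) = fun _ => 0 := by
      funext x
      simp [Model.meanCoord, Set.domRestrict_apply, Set.indicator_of_notMem x.2]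
    rw [h]
    exact measurable_const

theorem Model.Regular.measurable_sdCoord (hm : m.Regular t r lam0 lam1 D1 D2 D H M)
    (j : Fin p) : Measurable (m.sdCoord j) :=
  (hm.measurable_cov j j).sqrt.indicator measurableSet_Icc

theorem Model.Regular.posSemidef_cov (hm : m.Regular t r lam0 lam1 D1 D2 D H M)
    (hlam0 : 0 < lam0) {u : ℝ} (hu : u ∈ Set.Icc (0 : ℝ) 1) : (m.cov u).PosSemidef := by
  obtain ⟨hS, h⟩ := hm.eigenvalues_mem u hu
  exact hS.posSemidef_iff_eigenvalues_nonneg.2 fun i => hlam0.le.trans (h i).1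

theorem Model.Regular.sdCoord_sq_le (hm : m.Regular t r lam0 lam1 D1 D2 D H M)
    (hlam0 : 0 < lam0) {u : ℝ} (hu : u ∈ Set.Icc (0 : ℝ) 1) (j : Fin p) :
    m.sdCoord j u ^ 2 ≤ lam1 := by
  obtain ⟨hS, h⟩ := hm.eigenvalues_mem u hu
  rw [Model.sdCoord, Set.indicator_of_mem hu, Real.sq_sqrt (hm.posSemidef_cov hlam0 hu).diag_nonneg]
  exact diag_le_of_eigenvalues_le hS (fun i => (h i).2) j

/-- A Gaussian coordinate is its mean plus its standard deviation times a standard normal. The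
dependence on `u` moves from the measure into a measurable function, so a fixed product measure and
Fubini can be used. -/
theorem Model.Regular.multivariateGaussian_preimage (hm : m.Regular t r lam0 lam1 D1 D2 D H M)
    (hlam0 : 0 < lam0) {u : ℝ} (hu : u ∈ Set.Icc (0 : ℝ) 1) (y : Fin 2) (j : Fin p) {T : Set ℝ}
    (hT : MeasurableSet T) :
    multivariateGaussian (m.mean y u) (m.cov u) ((fun x => x j) ⁻¹' T)
      = gaussianReal 0 1 {z | m.meanCoord y j u + m.sdCoord j u * z ∈ T} := by
  have hS := hm.posSemidef_cov hlam0 hu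
  have h1 := measurePreserving_eval_multivariateGaussian (μ := m.mean y u) hS (i := j)
  rw [← Measure.map_apply h1.measurable hT, h1.map_eq]
  have h2 : gaussianReal (m.mean y u j) (m.cov u j j).toNNReal
      = (gaussianReal 0 1).map (fun z => m.meanCoord y j u + m.sdCoord j u * z) := by
    have : (fun z => m.meanCoord y j u + m.sdCoord j u * z)
        = (m.meanCoord y j u + ·) ∘ (m.sdCoord j u * ·) := rfl
    rw [this, ← Measure.map_map (by fun_prop) (by fun_prop), gaussianReal_map_const_mul,
      gaussianReal_map_const_add]
    congr 1
    · simp [Model.meanCoord, hu]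
    · ext
      simp [Model.sdCoord, hu, Real.sq_sqrt hS.diag_nonneg, hS.diag_nonneg]
  rw [h2, Measure.map_apply (by fun_prop) hT]
  rfl

variable {Ω : Type*} [MeasurableSpace Ω] {P : Measure Ω} [IsProbabilityMeasure P]
  {U : Fin N → Ω → ℝ} {Y : Fin N → Ω → Fin 2} {X : Fin N → Ω → EuclideanSpace ℝ (Fin p)}

/-- The normalisation of the density is not part of `Model.Regular`; it follows because the two
label probabilities, each half the total mass, add up to `1`. An observation `i` is needed for this.
-/
theorem IsSample.exposureLaw_univ (hs : IsSample m P U Y X) (i : Fin N) :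
    m.exposureLaw Set.univ = 1 := by
  have h1 : ∀ y, P {ω | Y i ω = y} = (1 / 2) * m.exposureLaw Set.univ := by
    intro y
    have := hs.law i y Set.univ Set.univ MeasurableSet.univ MeasurableSet.univ
    simp only [Set.mem_univ, true_and, and_true, Set.univ_inter, measure_univ, mul_one] at this
    rw [this, Model.exposureLaw, withDensity_apply _ MeasurableSet.univ, Measure.restrict_univ]
  have h2 : (1 : ENNReal) = P {ω | Y i ω = 0} + P {ω | Y i ω = 1} := by
    have hY1 : MeasurableSet {ω | Y i ω = 1} := hs.measurable_Y i (measurableSet_singleton 1)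
    rw [← measure_union _ hY1, ← measure_univ (μ := P)]
    · congr 1
      ext ω
      simp only [Set.mem_univ, Set.mem_union, Set.mem_ofPred_eq, true_iff]
      omega
    · rw [Set.disjoint_left]
      intro ω h h'
      simp only [Set.mem_ofPred_eq] at h h'
      omega
  rw [h1, h1, ← two_mul, ← mul_assoc] at h2
  rw [ENNReal.mul_div_cancel (by simp) (by simp), one_mul] at h2
  exact h2.symm

theorem IsSample.map_restrict (hs : IsSample m P U Y X) (hm : m.Regular t r lam0 lam1 D1 D2 D H M)
    (hlam0 : 0 < lam0) (i : Fin N) (y : Fin 2) (j : Fin p) :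
    (P.restrict {ω | Y i ω = y}).map (fun ω => (U i ω, X i ω j))
      = (1 / 2 : ENNReal) • (m.exposureLaw.prod (gaussianReal 0 1)).map
          (fun z => (z.1, m.meanCoord y j z.1 + m.sdCoord j z.1 * z.2)) := by
  have hU := hs.measurable_U i
  have hX := hs.measurable_X i
  have hXj : Measurable fun ω => X i ω j := by fun_prop
  have hYm : MeasurableSet {ω | Y i ω = y} := hs.measurable_Y i (measurableSet_singleton y)
  have hmean := hm.measurable_meanCoord y j
  have hsd := hm.measurable_sdCoord j
  have hφ : Measurable fun z : ℝ × ℝ => (z.1, m.meanCoord y j z.1 + m.sdCoord j z.1 * z.2) := by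
    fun_prop
  refine Measure.ext_prod fun {A T} hA hT => ?_
  rw [Measure.map_apply (hU.prodMk hXj) (hA.prod hT), Measure.smul_apply, smul_eq_mul,
    Measure.map_apply hφ (hA.prod hT), Measure.prod_apply (hφ (hA.prod hT)),
    Measure.restrict_apply ((hU.prodMk hXj) (hA.prod hT))]
  have hset : (fun ω => (U i ω, X i ω j)) ⁻¹' A ×ˢ T ∩ {ω | Y i ω = y}
      = {ω | U i ω ∈ A ∧ Y i ω = y ∧ X i ω ∈ (fun x : EuclideanSpace ℝ (Fin p) => x j) ⁻¹' T} := by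
    ext ω
    simp only [Set.mem_inter_iff, Set.mem_preimage, Set.mem_prod, Set.mem_ofPred_eq]
    tauto
  have hev : Measurable fun x : EuclideanSpace ℝ (Fin p) => x j := by fun_prop
  rw [hset, hs.law i y A _ hA (hev hT), Model.exposureLaw,
    lintegral_withDensity_eq_lintegral_mul _ hm.measurable_density.ennreal_ofReal
      (measurable_measure_prodMk_left (hφ (hA.prod hT)))]
  congr 1
  rw [← Measure.restrict_restrict hA, ← lintegral_indicator hA]
  refine setLIntegral_congr_fun measurableSet_Icc fun u hu => ?_
  simp only [Pi.mul_apply]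
  by_cases huA : u ∈ A
  · rw [Set.indicator_of_mem huA, hm.multivariateGaussian_preimage hlam0 hu y j hT]
    congr 2
    ext z
    simp [huA]
  · rw [Set.indicator_of_notMem huA]
    symm
    rw [mul_eq_zero]
    right
    have : Prod.mk u ⁻¹' ((fun z : ℝ × ℝ => (z.1, m.meanCoord y j z.1 + m.sdCoord j z.1 * z.2)) ⁻¹'
        A ×ˢ T) = ∅ := by
      ext z; simp [huA]
    rw [this, measure_empty]

theorem IsSample.setLIntegral_eq (hs : IsSample m P U Y X)
    (hm : m.Regular t r lam0 lam1 D1 D2 D H M)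
    (hlam0 : 0 < lam0) (i : Fin N) (y : Fin 2) (j : Fin p) {g : ℝ × ℝ → ENNReal}
    (hg : Measurable g) :
    ∫⁻ ω in {ω | Y i ω = y}, g (U i ω, X i ω j) ∂P = (1 / 2) * ∫⁻ u, ∫⁻ z,
      g (u, m.meanCoord y j u + m.sdCoord j u * z) ∂(gaussianReal 0 1) ∂m.exposureLaw := by
  have hU := hs.measurable_U i
  have hX := hs.measurable_X i
  have hXj : Measurable fun ω => X i ω j := by fun_prop
  have hmean := hm.measurable_meanCoord y j
  have hsd := hm.measurable_sdCoord j
  have hφ : Measurable fun z : ℝ × ℝ => (z.1, m.meanCoord y j z.1 + m.sdCoord j z.1 * z.2) := by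
    fun_prop
  have h := hs.map_restrict hm hlam0 i y j
  rw [← lintegral_map hg (hU.prodMk hXj), h, lintegral_smul_measure, lintegral_map hg hφ,
    lintegral_prod (fun z : ℝ × ℝ => g (z.1, m.meanCoord y j z.1 + m.sdCoord j z.1 * z.2))
      (hg.comp hφ).aemeasurable, smul_eq_mul]

/-- Conditionally on the labels, the observations of one class are independent. -/
theorem IsSample.lintegral_prod_cond (hs : IsSample m P U Y X)
    (hm : m.Regular t r lam0 lam1 D1 D2 D H M) (hlam0 : 0 < lam0) (y : Fin N → Fin 2) (l : Fin 2)
    (j : Fin p) {g : ℝ × ℝ → ENNReal} (hg : Measurable g) :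
    P {ω | ∀ i, Y i ω = y i} = (1 / 2) ^ N ∧
    ∫⁻ ω, ∏ i with y i = l, g (U i ω, X i ω j) ∂(cond P {ω | ∀ i, Y i ω = y i})
      = (∫⁻ u, ∫⁻ z, g (u, m.meanCoord l j u + m.sdCoord j u * z)
          ∂(gaussianReal 0 1) ∂m.exposureLaw) ^ (Finset.univ.filter fun i => y i = l).card := by
  classical
  set E := {ω | ∀ i, Y i ω = y i} with hE
  have hEm : MeasurableSet E := by
    have : E = ⋂ i, Y i ⁻¹' {y i} := by ext ω; simp [hE]
    rw [this]
    exact MeasurableSet.iInter fun i => hs.measurable_Y i (measurableSet_singleton _)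
  have hYi : ∀ i, MeasurableSet {ω | Y i ω = y i} := fun i =>
    hs.measurable_Y i (measurableSet_singleton _)
  have hone : ∀ i, P {ω | Y i ω = y i} = 1 / 2 := by
    intro i
    have := hs.law i (y i) Set.univ Set.univ MeasurableSet.univ MeasurableSet.univ
    simp only [Set.mem_univ, true_and, and_true, Set.univ_inter, measure_univ, mul_one] at this
    rw [this]
    have h1 := hs.exposureLaw_univ i
    rw [Model.exposureLaw, withDensity_apply _ MeasurableSet.univ, Measure.restrict_univ] at h1
    rw [h1, mul_one]
  have key : ∀ f : ℝ × ℝ → ENNReal, Measurable f →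
      ∫⁻ ω in E, ∏ i with y i = l, f (U i ω, X i ω j) ∂P = (1 / 2) ^ N *
        (∫⁻ u, ∫⁻ z, f (u, m.meanCoord l j u + m.sdCoord j u * z)
          ∂(gaussianReal 0 1) ∂m.exposureLaw) ^ (Finset.univ.filter fun i => y i = l).card := by
    intro f hf
    -- The indicator of the prescribed label is put into the factor of each observation, so
    -- independence factorises the integral over the event `E` itself.
    set G : Fin N → ℝ × Fin 2 × EuclideanSpace ℝ (Fin p) → ENNReal := fun i w =>
      (({y i} : Set (Fin 2)).indicator (fun _ => 1) w.2.1) *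
        if y i = l then f (w.1, w.2.2 j) else 1 with hG
    have hGm : ∀ i, Measurable (G i) := by
      intro i
      refine Measurable.mul ?_ ?_
      · exact (measurable_const.indicator (measurableSet_singleton _)).comp
          (measurable_fst.comp measurable_snd)
      · split_ifs
        · have : Measurable fun w : ℝ × Fin 2 × EuclideanSpace ℝ (Fin p) => (w.1, w.2.2 j) := by
            fun_prop
          exact hf.comp this
        · exact measurable_const
    have hind := hs.indep.comp G hGm
    have hmeas : ∀ i, Measurable (G i ∘ fun ω => (U i ω, Y i ω, X i ω)) := fun i =>
      (hGm i).comp ((hs.measurable_U i).prodMk ((hs.measurable_Y i).prodMk (hs.measurable_X i)))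
    have hprod := lintegral_prod_eq_prod_lintegral_of_indepFun Finset.univ _ hind hmeas
    have hGi : ∀ i ω, (G i ∘ fun ω => (U i ω, Y i ω, X i ω)) ω = {ω | Y i ω = y i}.indicator
        (fun ω => if y i = l then f (U i ω, X i ω j) else 1) ω := by
      intro i ω
      simp only [hG, Function.comp_apply, Set.indicator_apply, Set.mem_singleton_iff,
        Set.mem_ofPred_eq]
      split_ifs <;> simp
    have hlhs : ∀ ω, ∏ i, (G i ∘ fun ω => (U i ω, Y i ω, X i ω)) ω
        = E.indicator (fun ω => ∏ i with y i = l, f (U i ω, X i ω j)) ω := by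
      intro ω
      simp only [hGi]
      by_cases hω : ω ∈ E
      · rw [Set.indicator_of_mem hω, Finset.prod_filter]
        exact Finset.prod_congr rfl fun i _ => by
          rw [Set.indicator_of_mem (show ω ∈ {ω | Y i ω = y i} from hω i)]
      · rw [Set.indicator_of_notMem hω]
        simp only [hE, Set.mem_ofPred_eq, not_forall] at hω
        obtain ⟨i, hi⟩ := hω
        exact Finset.prod_eq_zero (Finset.mem_univ i) 
          (Set.indicator_of_notMem (show ω ∉ {ω | Y i ω = y i} from hi) _)
    simp only [hlhs] at hprod
    rw [lintegral_indicator hEm] at hprod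
    rw [hprod]
    have hfac : ∀ i, ∫⁻ ω, (G i ∘ fun ω => (U i ω, Y i ω, X i ω)) ω ∂P
        = (1 / 2) * if y i = l then (∫⁻ u, ∫⁻ z, f (u, m.meanCoord l j u + m.sdCoord j u * z)
          ∂(gaussianReal 0 1) ∂m.exposureLaw) else 1 := by
      intro i
      simp only [hGi]
      rw [lintegral_indicator (hYi i)]
      split_ifs with hil
      · rw [hs.setLIntegral_eq hm hlam0 i (y i) j hf, hil]
      · rw [setLIntegral_const, hone, one_mul, mul_one]
    simp only [hfac]
    rw [Finset.prod_mul_distrib, Finset.prod_const, Finset.card_univ, Fintype.card_fin,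
      ← Finset.prod_filter, Finset.prod_const]
  -- The same factorisation with `f = 1`; for `N = 0` the exposure law need not have mass one, but
  -- its exponent is zero.
  have hPE : P E = (1 / 2) ^ N := by
    have h1 := key (fun _ => 1) measurable_const
    have h2 : ∀ i : Fin N, m.exposureLaw Set.univ = 1 := fun i => hs.exposureLaw_univ i
    simp only [Finset.prod_const_one, lintegral_const, one_mul, measure_univ,
      Measure.restrict_apply MeasurableSet.univ, Set.univ_inter] at h1
    rw [h1]
    rcases isEmpty_or_nonempty (Fin N) with hN | ⟨⟨i⟩⟩
    · simp
    · rw [h2 i, one_pow, mul_one]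
  refine ⟨hPE, ?_⟩
  rw [ProbabilityTheory.cond, lintegral_smul_measure, key g hg, hPE, smul_eq_mul, ← mul_assoc,
    ENNReal.inv_mul_cancel (by simp) (by simp), one_mul]

end Law

/-! ### Tail bounds for the counts and the noise -/

section Concentration

variable {p N t : ℕ} {r lam0 lam1 D1 D2 D H M : ℝ} {m : Model p}
variable {Ω : Type*} [MeasurableSpace Ω] {P : Measure Ω} [IsProbabilityMeasure P]
  {U : Fin N → Ω → ℝ} {Y : Fin N → Ω → Fin 2} {X : Fin N → Ω → EuclideanSpace ℝ (Fin p)}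

/-- The exponential Markov inequality, conditionally on the labels. -/
theorem IsSample.exp_markov (hs : IsSample m P U Y X)
    (hm : m.Regular t r lam0 lam1 D1 D2 D H M) (hlam0 : 0 < lam0) (y : Fin N → Fin 2) (l : Fin 2)
    (j : Fin p) {φ : ℝ × ℝ → ℝ} (hφ : Measurable φ) {K : ℝ}
    (hK : ∫⁻ u, ∫⁻ z, ENNReal.ofReal (Real.exp (φ (u, m.meanCoord l j u + m.sdCoord j u * z)))
      ∂(gaussianReal 0 1) ∂m.exposureLaw ≤ ENNReal.ofReal (Real.exp K)) (T : ℝ) :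
    (cond P {ω | ∀ i, Y i ω = y i}).real {ω | T ≤ ∑ i with y i = l, φ (U i ω, X i ω j)}
      ≤ Real.exp ((Finset.univ.filter fun i => y i = l).card * K - T) := by
  set Q := cond P {ω | ∀ i, Y i ω = y i} with hQ
  set n := (Finset.univ.filter fun i => y i = l).card with hn
  have hg : Measurable fun z : ℝ × ℝ => ENNReal.ofReal (Real.exp (φ z)) := by fun_prop
  have h1 := (hs.lintegral_prod_cond hm hlam0 y l j hg).2
  have hprod : ∀ ω, ∏ i with y i = l, ENNReal.ofReal (Real.exp (φ (U i ω, X i ω j)))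
      = ENNReal.ofReal (Real.exp (∑ i with y i = l, φ (U i ω, X i ω j))) := fun ω => by
    rw [Real.exp_sum, ENNReal.ofReal_prod_of_nonneg fun _ _ => (Real.exp_pos _).le]
  simp only [hprod] at h1
  have hmeas : Measurable fun ω =>
      ENNReal.ofReal (Real.exp (∑ i with y i = l, φ (U i ω, X i ω j))) := by
    refine Measurable.ennreal_ofReal (Real.measurable_exp.comp ?_)
    refine Finset.measurable_fun_sum _ fun i _ => ?_
    have hX := hs.measurable_X i
    have hXj : Measurable fun ω => X i ω j := by fun_prop
    exact hφ.comp ((hs.measurable_U i).prodMk hXj)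
  have h2 := mul_meas_ge_le_lintegral (μ := Q) hmeas (ENNReal.ofReal (Real.exp T))
  have h3 : ENNReal.ofReal (Real.exp T) * Q {ω | T ≤ ∑ i with y i = l, φ (U i ω, X i ω j)}
      ≤ ENNReal.ofReal (Real.exp (n * K)) := by
    calc _ ≤ ENNReal.ofReal (Real.exp T) * Q {ω | ENNReal.ofReal (Real.exp T) ≤
          ENNReal.ofReal (Real.exp (∑ i with y i = l, φ (U i ω, X i ω j)))} := by
          gcongr with ω
          exact fun h => ENNReal.ofReal_le_ofReal (Real.exp_le_exp.2 h)
      _ ≤ _ := h2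
      _ ≤ ENNReal.ofReal (Real.exp K) ^ n := by rw [h1]; gcongr
      _ = _ := by rw [← ENNReal.ofReal_pow (Real.exp_pos _).le, ← Real.exp_nat_mul]
  have h4 : Q {ω | T ≤ ∑ i with y i = l, φ (U i ω, X i ω j)}
      ≤ ENNReal.ofReal (Real.exp (n * K - T)) := by
    have h5 : ENNReal.ofReal (Real.exp (-T)) * ENNReal.ofReal (Real.exp T) = 1 := by
      rw [← ENNReal.ofReal_mul (Real.exp_pos _).le, ← Real.exp_add]; simp
    calc _ = ENNReal.ofReal (Real.exp (-T)) * (ENNReal.ofReal (Real.exp T) *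
          Q {ω | T ≤ ∑ i with y i = l, φ (U i ω, X i ω j)}) := by rw [← mul_assoc, h5, one_mul]
      _ ≤ ENNReal.ofReal (Real.exp (-T)) * ENNReal.ofReal (Real.exp (n * K)) := by gcongr
      _ = _ := by
          rw [← ENNReal.ofReal_mul (Real.exp_pos _).le, ← Real.exp_add]; congr 2; ring
  exact ENNReal.toReal_le_of_le_ofReal (Real.exp_pos _).le h4

/-- On an indicator, `exp (a * 1_J) ≤ 1 + c * 1_J`; integrate and use `1 + x ≤ exp x`. Negative `a`
handles too few points, positive `a` too many. -/
theorem IsSample.count_tail (hs : IsSample m P U Y X)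
    (hm : m.Regular t r lam0 lam1 D1 D2 D H M) (hlam0 : 0 < lam0) (y : Fin N → Fin 2) (l : Fin 2)
    (j : Fin p) (i₀ : Fin N) {J : Set ℝ} (hJ : MeasurableSet J) {a c : ℝ}
    (hac : Real.exp a ≤ 1 + c) (T : ℝ) :
    (cond P {ω | ∀ i, Y i ω = y i}).real {ω | T ≤ a * classCount (fun i => U i ω) y l J}
      ≤ Real.exp ((Finset.univ.filter fun i => y i = l).card * (c * m.exposureLaw.real J) - T) := by
  have : IsProbabilityMeasure m.exposureLaw := ⟨hs.exposureLaw_univ i₀⟩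
  have hφ : Measurable fun z : ℝ × ℝ => a * J.indicator (fun _ => (1 : ℝ)) z.1 :=
    ((measurable_const.indicator hJ).comp measurable_fst).const_mul a
  have hind : Integrable (J.indicator fun _ => (1 : ℝ)) m.exposureLaw :=
    (integrable_const 1).indicator hJ
  have hK : ∫⁻ u, ∫⁻ _z, ENNReal.ofReal (Real.exp (a * J.indicator (fun _ => (1 : ℝ)) u))
      ∂(gaussianReal 0 1) ∂m.exposureLaw ≤
      ENNReal.ofReal (Real.exp (c * m.exposureLaw.real J)) := by
    simp only [lintegral_const, measure_univ, mul_one]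
    calc _ ≤ ∫⁻ u, ENNReal.ofReal (1 + c * J.indicator (fun _ => (1 : ℝ)) u) ∂m.exposureLaw := by
          refine lintegral_mono fun u => ENNReal.ofReal_le_ofReal ?_
          by_cases hu : u ∈ J <;> simp [hu, hac]
      _ = ENNReal.ofReal (∫ u, (1 + c * J.indicator (fun _ => (1 : ℝ)) u) ∂m.exposureLaw) := by
          refine (ofReal_integral_eq_lintegral_ofReal
            ((integrable_const 1).add (hind.const_mul c)) ?_).symm
          refine Eventually.of_forall fun u => ?_
          have := Real.exp_pos a
          by_cases hu : u ∈ J <;> (simp [hu]; try linarith)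
      _ = ENNReal.ofReal (1 + c * m.exposureLaw.real J) := by
          rw [integral_add (integrable_const 1) (hind.const_mul c), integral_const_mul,
            integral_indicator_const _ hJ]
          simp
      _ ≤ _ := by
          refine ENNReal.ofReal_le_ofReal ?_
          linarith [Real.add_one_le_exp (c * m.exposureLaw.real J)]
  have h := hs.exp_markov hm hlam0 y l j hφ hK T
  simp only [← Finset.mul_sum] at h
  exact h

theorem lintegral_exp_gaussianReal (s b : ℝ) :
    ∫⁻ z, ENNReal.ofReal (Real.exp (s * z - b)) ∂(gaussianReal 0 1)
      = ENNReal.ofReal (Real.exp (s ^ 2 / 2 - b)) := by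
  have hint : Integrable (fun z => Real.exp (s * z)) (gaussianReal 0 1) :=
    integrable_exp_mul_gaussianReal s
  have hmgf : ∫ z, Real.exp (s * z) ∂(gaussianReal 0 1) = Real.exp (s ^ 2 / 2) := by
    have := congrFun (mgf_fun_id_gaussianReal (μ := 0) (v := 1)) s
    simpa [mgf] using this
  simp only [sub_eq_add_neg, Real.exp_add]
  rw [← ofReal_integral_eq_lintegral_ofReal (hint.mul_const _)
    (Eventually.of_forall fun z => by positivity), integral_mul_const, hmgf]

/-- The weights are random and bounded only on the event considered. Subtracting `lam ^ 2 * lam1 / 2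
* b ^ 2` in the exponent compensates the Gaussian moment generating function for every `u`, so
Markov's inequality applies with `K = 0`; the sum of squares is replaced by `W` afterwards. -/
theorem IsSample.noise_tail_aux (hs : IsSample m P U Y X)
    (hm : m.Regular t r lam0 lam1 D1 D2 D H M) (hlam0 : 0 < lam0) (hlam1 : 0 < lam1)
    (y : Fin N → Fin 2) (l : Fin 2) (j : Fin p) (i₀ : Fin N) {b : ℝ → ℝ} (hb : Measurable b)
    {W x : ℝ} (hW : 0 < W) (hx : 0 ≤ x) {ε : ℝ} (hε : ε ^ 2 = 1) :
    (cond P {ω | ∀ i, Y i ω = y i}).real {ω | ∑ i with y i = l, b (U i ω) ^ 2 ≤ W ∧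
        x ≤ ε * ∑ i with y i = l, b (U i ω) * (X i ω j - m.meanCoord l j (U i ω))}
      ≤ Real.exp (-(x ^ 2 / (2 * lam1 * W))) := by
  have : IsProbabilityMeasure m.exposureLaw := ⟨hs.exposureLaw_univ i₀⟩
  -- The maximiser of `lam * x - lam ^ 2 * lam1 * W / 2`.
  set lam := x / (lam1 * W) with hlam
  have hlam' : 0 ≤ lam := by positivity
  have hmean := hm.measurable_meanCoord l j
  set φ : ℝ × ℝ → ℝ := fun z => ε * lam * b z.1 * (z.2 - m.meanCoord l j z.1)
    - lam ^ 2 * lam1 / 2 * b z.1 ^ 2 with hφd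
  have hφ : Measurable φ := by fun_prop
  have hK : ∫⁻ u, ∫⁻ z, ENNReal.ofReal (Real.exp (φ (u, m.meanCoord l j u + m.sdCoord j u * z)))
      ∂(gaussianReal 0 1) ∂m.exposureLaw ≤ ENNReal.ofReal (Real.exp 0) := by
    have hsd : ∀ u, m.sdCoord j u ^ 2 ≤ lam1 := by
      intro u
      by_cases hu : u ∈ Set.Icc (0 : ℝ) 1
      · exact hm.sdCoord_sq_le hlam0 hu j
      · rw [Model.sdCoord, Set.indicator_of_notMem hu]; simpa using hlam1.le
    calc _ ≤ ∫⁻ _u, ENNReal.ofReal (Real.exp 0) ∂m.exposureLaw := by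
          refine lintegral_mono fun u => ?_
          have e : ∀ z, φ (u, m.meanCoord l j u + m.sdCoord j u * z)
              = (ε * lam * b u * m.sdCoord j u) * z - lam ^ 2 * lam1 / 2 * b u ^ 2 := fun z => by
            simp only [hφd]; ring
          simp only [e]
          rw [lintegral_exp_gaussianReal]
          refine ENNReal.ofReal_le_ofReal (Real.exp_le_exp.2 ?_)
          have h1 : (ε * lam * b u * m.sdCoord j u) ^ 2
              = lam ^ 2 * b u ^ 2 * m.sdCoord j u ^ 2 := by
            rw [mul_pow, mul_pow, mul_pow, hε]; ring
          have h2 : lam ^ 2 * b u ^ 2 * m.sdCoord j u ^ 2 ≤ lam ^ 2 * b u ^ 2 * lam1 := by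
            gcongr; exact hsd u
          rw [h1]; linarith
      _ = _ := by simp
  have h := hs.exp_markov hm hlam0 y l j hφ hK (lam * x - lam ^ 2 * lam1 / 2 * W)
  have hPE := (hs.lintegral_prod_cond hm hlam0 y l j (g := fun _ => 1) measurable_const).1
  have : IsProbabilityMeasure (cond P {ω | ∀ i, Y i ω = y i}) :=
    cond_isProbabilityMeasure (by rw [hPE]; simp)
  refine (measureReal_mono ?_).trans (h.trans (le_of_eq ?_))
  · rintro ω ⟨h1, h2⟩
    have e : ∑ i with y i = l, φ (U i ω, X i ω j) = lam * (ε * ∑ i with y i = l,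
        b (U i ω) * (X i ω j - m.meanCoord l j (U i ω)))
        - lam ^ 2 * lam1 / 2 * ∑ i with y i = l, b (U i ω) ^ 2 := by
      simp only [Finset.mul_sum, ← Finset.sum_sub_distrib]
      exact Finset.sum_congr rfl fun i _ => by simp only [hφd]; ring
    rw [Set.mem_ofPred_eq, e]
    gcongr
  · congr 1
    rw [hlam]
    field_simp
    ring

/-- Sub-Gaussian tails of the weighted noise, on the event that the weights are controlled. -/
theorem IsSample.noise_tail (hs : IsSample m P U Y X)
    (hm : m.Regular t r lam0 lam1 D1 D2 D H M) (hlam0 : 0 < lam0) (hlam1 : 0 < lam1)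
    (y : Fin N → Fin 2) (l : Fin 2) (j : Fin p) (i₀ : Fin N) {b : ℝ → ℝ} (hb : Measurable b)
    {W x : ℝ} (hW : 0 < W) (hx : 0 ≤ x) :
    (cond P {ω | ∀ i, Y i ω = y i}).real {ω | ∑ i with y i = l, b (U i ω) ^ 2 ≤ W ∧
        x ≤ |∑ i with y i = l, b (U i ω) * (X i ω j - m.meanCoord l j (U i ω))|}
      ≤ 2 * Real.exp (-(x ^ 2 / (2 * lam1 * W))) := by
  have hPE := (hs.lintegral_prod_cond hm hlam0 y l j (g := fun _ => 1) measurable_const).1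
  have : IsProbabilityMeasure (cond P {ω | ∀ i, Y i ω = y i}) :=
    cond_isProbabilityMeasure (by rw [hPE]; simp)
  have h1 := hs.noise_tail_aux hm hlam0 hlam1 y l j i₀ hb hW hx (ε := 1) (by norm_num)
  have h2 := hs.noise_tail_aux hm hlam0 hlam1 y l j i₀ hb hW hx (ε := -1) (by norm_num)
  rw [two_mul]
  refine le_trans ((measureReal_mono ?_).trans (measureReal_union_le _ _)) (add_le_add h1 h2)
  rintro ω ⟨ha, hb⟩
  rcases le_abs.1 hb with h | h
  · exact Or.inl ⟨ha, by rwa [one_mul]⟩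
  · exact Or.inr ⟨ha, by rwa [neg_one_mul]⟩

theorem Model.Regular.exposureLaw_Icc (hm : m.Regular t r lam0 lam1 D1 D2 D H M) (hD1 : 0 ≤ D1)
    {a b : ℝ} (hab : a ≤ b) (hsub : Set.Icc a b ⊆ Set.Icc 0 1) :
    D1 * (b - a) ≤ m.exposureLaw.real (Set.Icc a b) ∧
      m.exposureLaw.real (Set.Icc a b) ≤ D2 * (b - a) := by
  have hD2 : 0 ≤ D2 := by
    have := hm.density_mem a (hsub (Set.left_mem_Icc.2 hab))
    linarith
  have hba : 0 ≤ b - a := by linarith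
  have h0 : m.exposureLaw (Set.Icc a b) = ∫⁻ u in Set.Icc a b, ENNReal.ofReal (m.density u) := by
    rw [Model.exposureLaw, withDensity_apply _ measurableSet_Icc,
      Measure.restrict_restrict measurableSet_Icc, Set.inter_eq_left.2 hsub]
  have hlow : ENNReal.ofReal (D1 * (b - a)) ≤ m.exposureLaw (Set.Icc a b) := by
    rw [h0, ENNReal.ofReal_mul hD1, ← Real.volume_Icc, ← setLIntegral_const]
    exact setLIntegral_mono' measurableSet_Icc fun u hu =>
      ENNReal.ofReal_le_ofReal (hm.density_mem u (hsub hu)).1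
  have hupp : m.exposureLaw (Set.Icc a b) ≤ ENNReal.ofReal (D2 * (b - a)) := by
    rw [h0, ENNReal.ofReal_mul hD2, ← Real.volume_Icc, ← setLIntegral_const]
    exact setLIntegral_mono' measurableSet_Icc fun u hu =>
      ENNReal.ofReal_le_ofReal (hm.density_mem u (hsub hu)).2
  constructor
  · exact (ENNReal.ofReal_le_iff_le_toReal (ne_top_of_le_ne_top ENNReal.ofReal_ne_top hupp)).1 hlow
  · exact ENNReal.toReal_le_of_le_ofReal (by positivity) hupp

theorem exp_neg_one_le_half : Real.exp (-1) ≤ 1 + -(1 / 2) := by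
  rw [Real.exp_neg]
  have h : (2 : ℝ) ≤ Real.exp 1 := by linarith [Real.add_one_le_exp (1 : ℝ)]
  have := inv_anti₀ two_pos h
  linarith

theorem exp_one_le_three : Real.exp 1 ≤ 1 + 2 := by linarith [Real.exp_one_lt_d9]

theorem IsSample.knotPiece_count_tail {q L : ℕ} {κ : ℝ} {τ : ℕ → ℝ} (hs : IsSample m P U Y X)
    (hm : m.Regular t r lam0 lam1 D1 D2 D H M) (hlam0 : 0 < lam0) (hD1 : 0 < D1)
    (hK : IsKnotSeq q L κ τ) (hκ : 1 ≤ κ) (y : Fin N → Fin 2) (l : Fin 2) (j : Fin p)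
    (i₀ : Fin N) {k a : ℕ} (hqk : q ≤ k) (hk : k < L) (ha : a ≤ q) :
    (cond P {ω | ∀ i, Y i ω = y i}).real {ω | classCount (fun i => U i ω) y l (knotPiece τ q k a) ≤
        D1 / (4 * (2 * q + 2) * κ) * (Finset.univ.filter fun i => y i = l).card / L}
      ≤ Real.exp (-(D1 / (4 * (2 * q + 2) * κ) *
          (Finset.univ.filter fun i => y i = l).card / L)) := by
  set n := (Finset.univ.filter fun i => y i = l).card with hn
  have hL : (0 : ℝ) < L := by exact_mod_cast (by omega : 0 < L)
  have hlt := hK.strict k hqk hk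
  have hg := sub_pos.2 hlt
  set c₀ := D1 / (4 * (2 * q + 2) * κ) with hc₀
  have hκ0 : 0 < κ := by linarith
  have h := hs.count_tail hm hlam0 y l j i₀ (J := knotPiece τ q k a) measurableSet_Icc
    exp_neg_one_le_half (-(c₀ * n / L))
  have hle : τ k + (2 * a) / (2 * q + 2) * (τ (k + 1) - τ k)
      ≤ τ k + (2 * a + 1) / (2 * q + 2) * (τ (k + 1) - τ k) := by
    gcongr; linarith
  have hsub : knotPiece τ q k a ⊆ Set.Icc 0 1 := fun x hx => by
    have := knotPiece_subset_Ico ha hlt hx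
    exact ⟨(hK.mem_Icc k).1.trans this.1, this.2.le.trans (hK.mem_Icc _).2⟩
  have hlaw := (hm.exposureLaw_Icc hD1.le hle hsub).1
  -- The `4` in `c₀` makes the expected count at least `4 * c₀ * n / L`; half of it minus the
  -- threshold `c₀ * n / L` leaves the required exponent.
  have hπ : 4 * c₀ / L ≤ m.exposureLaw.real (knotPiece τ q k a) := by
    refine le_trans ?_ hlaw
    have h1 := hK.one_le_mul_gap hκ hqk hk
    have e1 : (τ k + (2 * a + 1) / (2 * q + 2) * (τ (k + 1) - τ k))
        - (τ k + (2 * a) / (2 * q + 2) * (τ (k + 1) - τ k))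
        = (τ (k + 1) - τ k) / (2 * q + 2) := by field_simp; ring
    rw [e1]
    calc 4 * c₀ / L = D1 / ((2 * q + 2) * (κ * L)) * 1 := by rw [hc₀]; field_simp
      _ ≤ D1 / ((2 * q + 2) * (κ * L)) * (κ * L * (τ (k + 1) - τ k)) := by gcongr
      _ = _ := by field_simp
  have : IsProbabilityMeasure (cond P {ω | ∀ i, Y i ω = y i}) :=
    cond_isProbabilityMeasure (by
      rw [(hs.lintegral_prod_cond hm hlam0 y l j (g := fun _ => 1) measurable_const).1]; simp)
  refine (measureReal_mono fun ω hω => ?_).trans (h.trans (Real.exp_le_exp.2 ?_))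
  · rw [Set.mem_ofPred_eq] at hω ⊢
    linarith
  · have h2 : (n : ℝ) * (4 * c₀ / L) ≤ n * m.exposureLaw.real (knotPiece τ q k a) := by gcongr
    have e2 : (n : ℝ) * (4 * c₀ / L) = 4 * (c₀ * n / L) := by ring
    have e3 : (n : ℝ) * (-(1 / 2) * m.exposureLaw.real (knotPiece τ q k a))
      = -(1 / 2) * (n * m.exposureLaw.real (knotPiece τ q k a)) := by ring
    rw [e3]
    linarith

theorem IsSample.knotInterval_count_tail {q L : ℕ} {κ : ℝ} {τ : ℕ → ℝ} (hs : IsSample m P U Y X)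
    (hm : m.Regular t r lam0 lam1 D1 D2 D H M) (hlam0 : 0 < lam0) (hD1 : 0 < D1) (hD2 : D1 ≤ D2)
    (hK : IsKnotSeq q L κ τ) (y : Fin N → Fin 2) (l : Fin 2) (j : Fin p)
    (i₀ : Fin N) {k : ℕ} (hqk : q ≤ k) (hk : k < L) :
    (cond P {ω | ∀ i, Y i ω = y i}).real {ω | 3 * (D2 * (κ * (q + 1))) *
        (Finset.univ.filter fun i => y i = l).card / L ≤
          classCount (fun i => U i ω) y l (Set.Icc (τ k) (τ (k + 1)))}
      ≤ Real.exp (-(D2 * (κ * (q + 1)) * (Finset.univ.filter fun i => y i = l).card / L)) := by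
  set n := (Finset.univ.filter fun i => y i = l).card with hn
  have hL : (0 : ℝ) < L := by exact_mod_cast (by omega : 0 < L)
  have hlt := hK.strict k hqk hk
  have hg := sub_pos.2 hlt
  set B := D2 * (κ * (q + 1)) with hB
  have h := hs.count_tail hm hlam0 y l j i₀ (J := Set.Icc (τ k) (τ (k + 1))) measurableSet_Icc
    exp_one_le_three (3 * B * n / L)
  have hsub : Set.Icc (τ k) (τ (k + 1)) ⊆ Set.Icc 0 1 := fun x hx =>
    ⟨(hK.mem_Icc k).1.trans hx.1, hx.2.trans (hK.mem_Icc _).2⟩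
  have hlaw := (hm.exposureLaw_Icc hD1.le hlt.le hsub).2
  -- The exponent is then at most `2 * B * n / L - 3 * B * n / L`, hence the factor `3` in the
  -- threshold.
  have hπ : m.exposureLaw.real (Set.Icc (τ k) (τ (k + 1))) ≤ B / L := by
    refine hlaw.trans ?_
    rw [le_div_iff₀ hL, hB]
    have hD2' : 0 < D2 := by linarith
    calc _ = D2 * (L * (τ (k + 1) - τ k)) := by ring
      _ ≤ _ := mul_le_mul_of_nonneg_left (hK.mul_gap_le hqk hk) hD2'.le
  simp only [one_mul] at h
  refine h.trans (Real.exp_le_exp.2 ?_)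
  have h2 : (n : ℝ) * m.exposureLaw.real (Set.Icc (τ k) (τ (k + 1))) ≤ n * (B / L) := by gcongr
  have e1 : 3 * B * n / L = 3 * (n * (B / L)) := by ring
  have e2 : B * n / L = n * (B / L) := by ring
  have e3 : (n : ℝ) * (2 * m.exposureLaw.real (Set.Icc (τ k) (τ (k + 1))))
      = 2 * (n * m.exposureLaw.real (Set.Icc (τ k) (τ (k + 1)))) := by ring
  rw [e1, e2, e3]
  linarith

end Concentration

/-! ### The good event for a fixed sample size -/

theorem measurable_basis (q L : ℕ) (τ : ℕ → ℝ) (k : Fin L) :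
    Measurable fun u => basis q L τ u k :=
  (measurable_bspline τ q k).const_mul _

theorem basis_mul_sub_meanCoord {q L p : ℕ} {κ : ℝ} {τ : ℕ → ℝ} (hK : IsKnotSeq q L κ τ)
    (m : Model p) (l : Fin 2) (j : Fin p) (k : Fin L) (u x : ℝ) :
    basis q L τ u k * (x - m.meanCoord l j u) = basis q L τ u k * (x - m.mean l u j) := by
  by_cases hu : u ∈ Set.Icc (0 : ℝ) 1
  · rw [Model.meanCoord, Set.indicator_of_mem hu]
  · simp [basis, hK.bspline_eq_zero_of_notMem hu]

theorem EvenDesign.sum_basis_sq_le {q L N : ℕ} {κ c₀ C₀ s : ℝ} {τ : ℕ → ℝ} {U : Fin N → ℝ}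
    {Y : Fin N → Fin 2} {l : Fin 2} (hE : EvenDesign q L τ U Y l c₀ C₀ s)
    (hK : IsKnotSeq q L κ τ) (hC₀ : 0 ≤ C₀) (hs : 0 ≤ s) (k : Fin L) :
    ∑ i with Y i = l, basis q L τ (U i) k ^ 2 ≤ (q + 1) * C₀ * s := by
  have h := hE.gram_apply_le hK hC₀ hs k k
  rw [gram_apply] at h
  refine le_trans (le_of_eq ?_) ((le_abs_self _).trans h)
  exact Finset.sum_congr rfl fun i _ => sq _

section FiniteSample

variable {p N t : ℕ} {r lam0 lam1 D1 D2 D H M : ℝ} {m : Model p}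
variable {Ω : Type*} [MeasurableSpace Ω] {P : Measure Ω} [IsProbabilityMeasure P]
  {U : Fin N → Ω → ℝ} {Y : Fin N → Ω → Fin 2} {X : Fin N → Ω → EuclideanSpace ℝ (Fin p)}

/-- With high conditional probability the design is even and all the weighted noise sums are
small. -/
theorem IsSample.even_design_and_small_noise {q L n : ℕ} {κ : ℝ} {τ : ℕ → ℝ}
    (hs : IsSample m P U Y X)
    (hm : m.Regular t r lam0 lam1 D1 D2 D H M) (hlam0 : 0 < lam0) (hlam1 : 0 < lam1)
    (hD1 : 0 < D1) (hD2 : D1 ≤ D2) (hK : IsKnotSeq q L κ τ) (hκ : 1 ≤ κ) (hp : 1 ≤ p)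
    (y : Fin N → Fin 2) (l : Fin 2) (i₀ : Fin N) (hn : 0 < n)
    (hcard : (Finset.univ.filter fun i => y i = l).card = n) {V δ : ℝ} (hV : 0 ≤ V)
    (hδ : (q + 2) * Real.exp (-(D1 / (4 * (2 * q + 2) * κ) * n / L)) ≤ δ)
    (hVδ : Real.exp (-(V ^ 2 / (2 * lam1 * ((q + 1) * (3 * (D2 * (κ * (q + 1)))) * n)))) ≤ δ) :
    1 - 3 * p * L * δ ≤ (cond P {ω | ∀ i, Y i ω = y i}).real {ω | (∀ i, Y i ω = y i) ∧
      EvenDesign q L τ (fun i => U i ω) y l (D1 / (4 * (2 * q + 2) * κ))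
        (3 * (D2 * (κ * (q + 1)))) n ∧
      ∀ (j : Fin p) (k : Fin L), |∑ i with y i = l,
        basis q L τ (U i ω) k * (X i ω j - m.mean l (U i ω) j)| ≤ V} := by
  have hL : (0 : ℝ) < L := by
    have := hK.lt_card
    exact_mod_cast (by omega : 0 < L)
  have hn' : (0 : ℝ) < n := by exact_mod_cast hn
  have hD2' : 0 < D2 := by linarith
  have hκ0 : 0 < κ := by linarith
  set c₀ := D1 / (4 * (2 * q + 2) * κ) with hc₀
  set B := D2 * (κ * (q + 1)) with hB
  set e := Real.exp (-(c₀ * n / L)) with he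
  set W := (q + 1) * (3 * B) * n with hW
  have hW0 : 0 < W := by positivity
  set E := {ω | ∀ i, Y i ω = y i} with hE
  have hPE : P E = (1 / 2) ^ N :=
    (hs.lintegral_prod_cond hm hlam0 y l ⟨0, hp⟩ (g := fun _ => 1) measurable_const).1
  have hprob : IsProbabilityMeasure (cond P E) := cond_isProbabilityMeasure (by rw [hPE]; simp)
  set Q := cond P E with hQ
  have hQE : Q.real E = 1 := by
    have : Q E = 1 := cond_apply_self (by rw [hPE]; simp) (measure_ne_top _ _)
    rw [measureReal_def, this, ENNReal.toReal_one]
  -- Thus the single exponential `e` dominates both kinds of count tails.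
  have hc₀B : c₀ ≤ B := by
    have h1 : c₀ ≤ D1 := div_le_self hD1.le (by nlinarith [show (0 : ℝ) ≤ q by positivity])
    have h2 : D2 * 1 ≤ D2 * (κ * (q + 1)) :=
      mul_le_mul_of_nonneg_left (by nlinarith [show (0 : ℝ) ≤ q by positivity]) hD2'.le
    linarith
  let B1 : ℕ → ℕ → Set Ω := fun k a =>
    {ω | classCount (fun i => U i ω) y l (knotPiece τ q k a) ≤ c₀ * n / L}
  let B2 : ℕ → Set Ω := fun k =>
    {ω | 3 * B * n / L ≤ classCount (fun i => U i ω) y l (Set.Icc (τ k) (τ (k + 1)))}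
  -- The restriction on the weights costs nothing: an even design satisfies it automatically.
  let B3 : Fin p → Fin L → Set Ω := fun j k =>
    {ω | ∑ i with y i = l, basis q L τ (U i ω) k ^ 2 ≤ W ∧
      V ≤ |∑ i with y i = l, basis q L τ (U i ω) k * (X i ω j - m.meanCoord l j (U i ω))|}
  have hB1 : ∀ k ∈ Finset.Ico q L, ∀ a ∈ Finset.range (q + 1), Q.real (B1 k a) ≤ e := by
    intro k hk a ha
    rw [Finset.mem_Ico] at hk
    have := hs.knotPiece_count_tail hm hlam0 hD1 hK hκ y l ⟨0, hp⟩ i₀ hk.1 hk.2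
      (Nat.lt_succ_iff.1 (Finset.mem_range.1 ha))
    rwa [hcard] at this
  have hB2 : ∀ k ∈ Finset.Ico q L, Q.real (B2 k) ≤ e := by
    intro k hk
    rw [Finset.mem_Ico] at hk
    have := hs.knotInterval_count_tail hm hlam0 hD1 hD2 hK y l ⟨0, hp⟩ i₀ hk.1 hk.2
    rw [hcard] at this
    refine this.trans (Real.exp_le_exp.2 (neg_le_neg ?_))
    gcongr
  have hB3 : ∀ j k, Q.real (B3 j k) ≤ 2 * δ := by
    intro j k
    have := hs.noise_tail hm hlam0 hlam1 y l j i₀ (measurable_basis q L τ k) hW0 hV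
    exact this.trans (by gcongr)
  set Bad : Set Ω := ((⋃ k ∈ Finset.Ico q L, ⋃ a ∈ Finset.range (q + 1), B1 k a) ∪
    ⋃ k ∈ Finset.Ico q L, B2 k) ∪ ⋃ j ∈ Finset.univ, ⋃ k ∈ Finset.univ, B3 j k with hBad
  have hIco : ((Finset.Ico q L).card : ℝ) ≤ L := by
    rw [Nat.card_Ico]; exact_mod_cast Nat.sub_le _ _
  have he0 : 0 < e := Real.exp_pos _
  have hδ0 : 0 < δ := lt_of_lt_of_le (by positivity) hδ
  have hm1 : Q.real (⋃ k ∈ Finset.Ico q L, ⋃ a ∈ Finset.range (q + 1), B1 k a)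
      ≤ L * ((q + 1) * e) := by
    refine (measureReal_biUnion_finset_le _ _).trans ?_
    calc _ ≤ ∑ k ∈ Finset.Ico q L, (q + 1) * e := by
          refine Finset.sum_le_sum fun k hk => (measureReal_biUnion_finset_le _ _).trans ?_
          refine (Finset.sum_le_sum fun a ha => hB1 k hk a ha).trans (le_of_eq ?_)
          simp
      _ ≤ _ := by
          rw [Finset.sum_const, nsmul_eq_mul]; gcongr
  have hm2 : Q.real (⋃ k ∈ Finset.Ico q L, B2 k) ≤ L * e := by
    refine (measureReal_biUnion_finset_le _ _).trans ((Finset.sum_le_sum hB2).trans ?_)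
    rw [Finset.sum_const, nsmul_eq_mul]; gcongr
  have hm3 : Q.real (⋃ j ∈ Finset.univ, ⋃ k ∈ Finset.univ, B3 j k) ≤ p * (L * (2 * δ)) := by
    refine (measureReal_biUnion_finset_le _ _).trans ?_
    calc _ ≤ ∑ j : Fin p, (L * (2 * δ) : ℝ) := by
          refine Finset.sum_le_sum fun j _ => (measureReal_biUnion_finset_le _ _).trans ?_
          refine (Finset.sum_le_sum fun k _ => hB3 j k).trans (le_of_eq ?_)
          simp
      _ = _ := by simp
  -- The counts contribute `L * (q + 2) * e ≤ p * L * δ`, the noise sums `2 * p * L * δ`.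
  have hbad : Q.real Bad ≤ 3 * p * L * δ := by
    have h1 := (measureReal_union_le (μ := Q)
      ((⋃ k ∈ Finset.Ico q L, ⋃ a ∈ Finset.range (q + 1), B1 k a) ∪
        ⋃ k ∈ Finset.Ico q L, B2 k) (⋃ j ∈ Finset.univ, ⋃ k ∈ Finset.univ, B3 j k))
    have h2 := (measureReal_union_le (μ := Q)
      (⋃ k ∈ Finset.Ico q L, ⋃ a ∈ Finset.range (q + 1), B1 k a) (⋃ k ∈ Finset.Ico q L, B2 k))
    have h3 : (L : ℝ) * ((q + 1) * e) + L * e ≤ L * δ := by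
      calc _ = L * ((q + 2) * e) := by ring
        _ ≤ _ := by gcongr
    have h4 : (1 : ℝ) * (L * δ) ≤ p * (L * δ) := by
      gcongr; exact_mod_cast hp
    calc Q.real Bad ≤ L * δ + p * (L * (2 * δ)) := by linarith
      _ ≤ _ := by linarith
  have hdiff := le_measureReal_sdiff (μ := Q) (s₁ := E) (s₂ := Bad)
  rw [hQE] at hdiff
  refine le_trans (by linarith) (hdiff.trans (measureReal_mono ?_))
  rintro ω ⟨hωE, hω⟩
  simp only [hBad, Set.mem_union, Set.mem_iUnion, not_or, not_exists] at hω
  obtain ⟨⟨h1, h2⟩, h3⟩ := hω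
  have heven : EvenDesign q L τ (fun i => U i ω) y l c₀ (3 * B) n := by
    refine ⟨fun k hk1 hk2 a ha => ?_, fun k hk1 hk2 => ?_⟩
    · exact (not_le.1 (h1 k (Finset.mem_Ico.2 ⟨hk1, hk2⟩) a
        (Finset.mem_range.2 (Nat.lt_succ_iff.2 ha)))).le
    · exact (not_le.1 (h2 k (Finset.mem_Ico.2 ⟨hk1, hk2⟩))).le
  refine ⟨hωE, heven, fun j k => ?_⟩
  by_contra hcon
  refine h3 j (Finset.mem_univ _) k (Finset.mem_univ _) ⟨?_, ?_⟩
  · exact heven.sum_basis_sq_le hK (by positivity) hn'.le k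
  · simp only [basis_mul_sub_meanCoord hK]
    exact (not_le.1 hcon).le

end FiniteSample

/-! ### Large samples and the final rate -/

/-- Eventually `c * n / L n` exceeds `(ϑ + 1) * log n`; the extra power of `n` absorbs the factor `q
+ 2`. -/
theorem eventually_exp_le_rpow (q : ℕ) {c ϑ : ℝ} (hc : 0 < c) (hϑ : 0 < ϑ) {L : ℕ → ℕ}
    (hL : Tendsto (fun n => (L n : ℝ) * Real.log n / n) atTop (𝓝 0)) :
    ∀ᶠ n : ℕ in atTop, 0 < L n → (q + 2) * Real.exp (-(c * n / L n)) ≤ (n : ℝ) ^ (-ϑ) := by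
  have h1 : ∀ᶠ n : ℕ in atTop, (L n : ℝ) * Real.log n / n < c / (ϑ + 1) :=
    hL.eventually (gt_mem_nhds (by positivity))
  filter_upwards [h1, eventually_ge_atTop (q + 2)] with n hn hq hLn
  have hn0 : (0 : ℝ) < n := by exact_mod_cast (by omega : 0 < n)
  have hLn' : (0 : ℝ) < L n := by exact_mod_cast hLn
  have hqn : (q : ℝ) + 2 ≤ n := by exact_mod_cast hq
  have h2 : Real.log n * (ϑ + 1) ≤ c * n / L n := by
    rw [div_lt_div_iff₀ hn0 (by positivity)] at hn
    rw [le_div_iff₀ hLn']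
    linarith
  calc _ ≤ (n : ℝ) * Real.exp (-(Real.log n * (ϑ + 1))) := by gcongr
    _ = (n : ℝ) ^ (1 : ℝ) * (n : ℝ) ^ (-(ϑ + 1)) := by
        rw [Real.rpow_one, Real.rpow_def_of_pos hn0, mul_neg]
    _ = _ := by rw [← Real.rpow_add hn0]; congr 1; ring

end VCLDA

theorem mainTheorem8 (q t : ℕ) (r d lam0 lam1 D1 D2 D H M κ ϑ : ℝ)
    (hr0 : 0 < r) (hr1 : r ≤ 1) (hd : d = t + r) (hd1 : 1 ≤ d) (hq : t ≤ q)
    (hlam0 : 0 < lam0) (hlam1 : lam0 ≤ lam1) (hD1 : 0 < D1) (hD2 : D1 ≤ D2) (hϑ : 0 < ϑ) :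
    ∃ C : ℝ, 0 < C ∧
      ∀ p L : ℕ → ℕ,
        (∀ n, 1 ≤ p n) →
        ((fun n => (p n : ℝ)) =o[atTop] fun n => (n : ℝ) ^ ((2 * d - 1) / (2 * d + 1))) →
        Tendsto (fun n => (L n : ℝ) * Real.log n / n) atTop (𝓝 0) →
        ∀ᶠ n in atTop,
          ∀ (τ : ℕ → ℝ), VCLDA.IsKnotSeq q (L n) κ τ →
          ∀ m : VCLDA.Model (p n), m.Regular t r lam0 lam1 D1 D2 D H M →
          ∀ (Ω : Type*) [MeasurableSpace Ω] (P : Measure Ω) [IsProbabilityMeasure P]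
            (U : Fin (2 * n) → Ω → ℝ) (Y : Fin (2 * n) → Ω → Fin 2)
            (X : Fin (2 * n) → Ω → EuclideanSpace ℝ (Fin (p n))),
          VCLDA.IsSample m P U Y X →
          ∀ y : Fin (2 * n) → Fin 2,
            (∀ l, (Finset.univ.filter fun i => y i = l).card = n) →
          ∀ l : Fin 2,
            1 - 3 * (p n : ℝ) * (L n : ℝ) * (n : ℝ) ^ (-ϑ) ≤
              (cond P {ω | ∀ i, Y i ω = y i}).real
                {ω | IsUnit (VCLDA.gram q (L n) τ (fun i => U i ω) (fun i => Y i ω) l).det ∧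
                  ∀ u ∈ Set.Icc (0 : ℝ) 1,
                    ‖(fun j => VCLDA.muHat q (L n) τ (fun i => U i ω) (fun i => Y i ω)
                        (fun i => X i ω) l u j - m.mean l u j)‖ ≤
                      C * (Real.sqrt ((L n : ℝ) * Real.log n / n) + (L n : ℝ) ^ (-d))} := by
  by_cases hκ : 1 ≤ κ
  swap
  -- For `κ < 1` there is no knot sequence: a positive gap would be smaller than itself.
  · refine ⟨1, one_pos, fun p L _ _ _ => Eventually.of_forall fun n τ hK => ?_⟩
    have h1 := hK.strict q le_rfl hK.lt_card
    have h2 := hK.quasiUniform q q le_rfl hK.lt_card le_rfl hK.lt_card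
    nlinarith
  have hκ0 : 0 < κ := by linarith
  have hD2' : 0 < D2 := by linarith
  have hlam1' : 0 < lam1 := by linarith
  set c₀ := D1 / (4 * (2 * q + 2) * κ) with hc₀
  set B := 3 * (D2 * (κ * (q + 1))) with hB
  have hc₀0 : 0 < c₀ := by positivity
  have hB0 : 0 < B := by positivity
  obtain ⟨C, hC, hest⟩ := VCLDA.exists_estimation_bound q t (r := r) D H hr0 hq hκ hc₀0 hB0
  -- Chosen so that the Gaussian exponent at `V = G * √(n log n)` is exactly `ϑ * log n`.
  set G := Real.sqrt (2 * lam1 * ((q + 1) * B) * ϑ) with hG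
  refine ⟨C * (G + 1), by positivity, fun p L hp _ hL => ?_⟩
  filter_upwards [VCLDA.eventually_exp_le_rpow q hc₀0 hϑ hL, eventually_ge_atTop 1] with n hexp hn1
  intro τ hK m hm Ω _ P _ U Y X hs y hy l
  have hn0 : (0 : ℝ) < n := by exact_mod_cast hn1
  have hlog : 0 ≤ Real.log n := Real.log_natCast_nonneg n
  have hLn : 0 < L n := by have := hK.lt_card; omega
  have hLn' : (0 : ℝ) < L n := by exact_mod_cast hLn
  set V := G * Real.sqrt (n * Real.log n) with hV
  have hV2 : Real.exp (-(V ^ 2 / (2 * lam1 * ((q + 1) * B * n)))) ≤ (n : ℝ) ^ (-ϑ) := by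
    rw [hV, mul_pow, hG, Real.sq_sqrt (by positivity), Real.sq_sqrt (by positivity),
      Real.rpow_def_of_pos hn0]
    refine le_of_eq (congrArg Real.exp ?_)
    field_simp
  refine (hs.even_design_and_small_noise hm hlam0 hlam1' hD1 hD2 hK hκ (hp n) y l
    ⟨0, by omega⟩ hn1 (hy l) (by positivity) (hexp hLn) hV2).trans ?_
  have hprob : IsProbabilityMeasure (cond P {ω | ∀ i, Y i ω = y i}) :=
    cond_isProbabilityMeasure (by
      rw [(hs.lintegral_prod_cond hm hlam0 y l ⟨0, hp n⟩ (g := fun _ => 1) measurable_const).1]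
      simp)
  refine measureReal_mono ?_
  rintro ω ⟨hYω, hE, hnoise⟩
  -- The estimator uses the random labels, whereas the bounds are stated for the fixed configuration
  -- `y`.
  have hYe : (fun i => Y i ω) = y := funext hYω
  rw [Set.mem_ofPred_eq, hYe]
  obtain ⟨hdet, hbound⟩ := hest (L n) τ hK (2 * n) (fun i => U i ω) y l n hn0 hE
  refine ⟨hdet, fun u hu => ?_⟩
  rw [pi_norm_le_iff_of_nonneg (by positivity)]
  intro j
  have h := hbound _ (hm.mean_holder l j) (fun i => X i ω j) V (hnoise j) u hu
  rw [Real.norm_eq_abs]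
  refine h.trans ?_
  have e : Real.sqrt (L n) * V / n = G * Real.sqrt ((L n : ℝ) * Real.log n / n) := by
    rw [hV, Real.sqrt_mul hn0.le, Real.sqrt_div (by positivity), Real.sqrt_mul hLn'.le]
    have h1 : Real.sqrt n ≠ 0 := (Real.sqrt_pos.2 hn0).ne'
    have h2 := Real.sq_sqrt hn0.le
    field_simp
    rw [h2]
    ring
  rw [e, hd, mul_assoc]
  have hG0 : 0 ≤ G := Real.sqrt_nonneg _
  have hr : 0 ≤ (L n : ℝ) ^ (-((t : ℝ) + r)) := by positivity
  have hsq := Real.sqrt_nonneg ((L n : ℝ) * Real.log n / n)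
  gcongr
  nlinarith [mul_nonneg hG0 hr]
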